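/- For $\rho\in(0,\infty]$ and $x\in\mathbb R^k$ let $\|x\|_\rho=(\sum_i|x_i|^\rho)^{1/\rho}$ (and $\|x\|_\infty=\max_i|x_i|$), and for a real $m\times n$ matrix $X$ and $\rho,\sigma\in(0,\infty]$ let $\|X\colon\ell_\rho^n\to\ell_\sigma^m\|=\sup\{\|Xt\|_\sigma : t\in\mathbb R^n,\ \|t\|_\rho\le 1\}$. For $p\in[1,\infty]$ let $p^*$ be its Hölder conjugate, $1/p+1/p^*=1$. Let $(c_i^*)_{i\le k}$ denote the nonincreasing rearrangement of $(|c_i|)_{i\le k}$. For $p,q\in[1,\infty]$, a deterministic matrix $A=(a_{i,j})_{i\le m,j\le n}$, and independent standard Gaussian random variables $g_{i,j}$, let $G_A=(a_{i,j}g_{i,j})_{i\le m,j\le n}$ and $$D_1=\|(a_{i,j}^2)_{i\le m,j\le n}\colon\ell_{p/2}^n\to\ell_{q/2}^m\|^{1/2},\qquad D_2=\|(a_{i,j}^2)_{j\le n,i\le m}\colon\ell_{q^*/2}^m\to\ell_{p^*/2}^n\|^{1/2},$$ $$D_3=\begin{cases}\mathbb E\max_{i\le m,j\le n}|a_{i,j}g_{i,j}|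 & \text{if } p\le 2\le q,\\ \max_{j\le n}\sqrt{\ln(j+1)}\,\beta_j^* & \text{if } p\le q\le 2,\\ \max_{i\le m}\sqrt{\ln(i+1)}\,\delta_i^* & \text{if } 2\le p\le q,\\ 0 & \text{if } q<p,\end{cases}$$ where the first applicable line is used, $\beta_j=\|(a_{i,j})_{i\le m}\|_{2q/(2-q)}$ and $\delta_i=\|(a_{i,j})_{j\le n}\|_{2p/(p-2)}$ (the exponent $2q/(2-q)$ is $\infty$ for $q=2$; the exponent $2p/(p-2)$ is $\infty$ for $p=2$ and $2$ for $p=\infty$). Suppose that $A$ has tensor form: there are $a\in\mathbb R^m$, $b\in\mathbb R^n$ with $a_{i,j}=a_ib_j$ for all $i\le m$, $j\le n$. Then: 1. For all $p,q\in[1,\infty]$ the norm $\|G_A\colon\ell_p^n\to\ell_q^m\|$ is integrable and $$c_{p,q}\,(D_1+D_2+D_3)\le\mathbb E\|G_A\colon\ell_p^n\to\ell_q^m\|\le C_{p,q}\,(D_1+D_2+D_3),$$ where $c_{p,q},C_{p,q}\in(0,\infty)$ depend only on $p$ and $q$ (not on $m,n,a,b$). 2. If moreover $p^*<\infty$ and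 $q<\infty$, then $$c\,(D_1+D_2)\le\mathbb E\|G_A\colon\ell_p^n\to\ell_q^m\|\le C\bigl(\sqrt q\,D_1+\sqrt{p^*}\,D_2\bigr),$$ where $c,C\in(0,\infty)$ are universal constants (not depending on $p,q,m,n,a,b$). -/

import Mathlib

open MeasureTheory ProbabilityTheory
open scoped ENNReal

/-- The `ℓ_ρ` (quasi-)norm of a vector `x ∈ ℝᵏ`, for `ρ ∈ (0, ∞]`:
`(∑ |x i| ^ ρ) ^ (1 / ρ)` for `ρ < ∞` and `max |x i|` for `ρ = ∞`
(this is Mathlib's norm of `PiLp`, which is defined also for `ρ < 1`). -/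
noncomputable def ellNorm {k : ℕ} (ρ : ℝ≥0∞) (x : Fin k → ℝ) : ℝ :=
  ‖WithLp.toLp ρ x‖

/-- The operator (quasi-)norm of an `m × n` matrix `X` from `ℓ_ρⁿ` to `ℓ_σᵐ`:
the supremum of `‖X t‖_σ` over the unit ball `‖t‖_ρ ≤ 1`. -/
noncomputable def ellOpNorm {m n : ℕ} (ρ σ : ℝ≥0∞) (X : Matrix (Fin m) (Fin n) ℝ) : ℝ :=
  ⨆ t : {t : Fin n → ℝ // ellNorm ρ t ≤ 1}, ellNorm σ (X.mulVec t.1)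

/-- The nonincreasing rearrangement of `(|c i|)_i`. -/
noncomputable def decrRearr {k : ℕ} (c : Fin k → ℝ) : Fin k → ℝ :=
  fun i => |c (Tuple.sort (fun l => -|c l|) i)|

/-- The structured matrix `G_A = (A i j * g i j)`, as a random matrix. -/
def structuredMatrix {m n : ℕ} {Ω : Type*} (A : Matrix (Fin m) (Fin n) ℝ)
    (g : Fin m → Fin n → Ω → ℝ) (ω : Ω) : Matrix (Fin m) (Fin n) ℝ :=
  Matrix.of fun i j => A i j * g i j ω

/-- `g i j`, `i ≤ m`, `j ≤ n`, are iid standard Gaussian random variables. -/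
structure IsIIDStdGaussian {m n : ℕ} {Ω : Type*} [MeasurableSpace Ω]
    (g : Fin m → Fin n → Ω → ℝ) (μ : Measure Ω) : Prop where
  hasLaw : ∀ i j, HasLaw (g i j) (gaussianReal 0 1) μ
  indep : iIndepFun (fun ij : Fin m × Fin n => g ij.1 ij.2) μ

/-- `D₁ = ‖(a_{ij}²)_{i,j} : ℓ_{p/2}ⁿ → ℓ_{q/2}ᵐ‖ ^ (1/2)`. -/
noncomputable def D1 {m n : ℕ} (p q : ℝ≥0∞) (A : Matrix (Fin m) (Fin n) ℝ) : ℝ :=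
  √(ellOpNorm (p / 2) (q / 2) (A.map (· ^ 2)))

/-- `D₂ = ‖(a_{ij}²)_{j,i} : ℓ_{q*/2}ᵐ → ℓ_{p*/2}ⁿ‖ ^ (1/2)`, with `p*`, `q*` the Hölder conjugates. -/
noncomputable def D2 {m n : ℕ} (p q : ℝ≥0∞) (A : Matrix (Fin m) (Fin n) ℝ) : ℝ :=
  √(ellOpNorm (q.conjExponent / 2) (p.conjExponent / 2) (A.map (· ^ 2)).transpose)

/-- `b_j = ‖(a_{ij})_i‖_{2q/(2-q)}` for `q ≤ 2`. The exponent is written `1 / (1/q - 1/2)`,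
which is `∞` for `q = 2`. -/
noncomputable def colNorm {m n : ℕ} (q : ℝ≥0∞) (A : Matrix (Fin m) (Fin n) ℝ) (j : Fin n) : ℝ :=
  ellNorm (q⁻¹ - 2⁻¹)⁻¹ (fun i => A i j)

/-- `d_i = ‖(a_{ij})_j‖_{2p/(p-2)}` for `p ≥ 2`. The exponent is written `1 / (1/2 - 1/p)`,
which is `∞` for `p = 2` and `2` for `p = ∞`. -/
noncomputable def rowNorm {m n : ℕ} (p : ℝ≥0∞) (A : Matrix (Fin m) (Fin n) ℝ) (i : Fin m) : ℝ :=
  ellNorm (2⁻¹ - p⁻¹)⁻¹ (fun j => A i j)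

open Classical in
/-- The term `D₃`; the first case that applies is used. The indices of `Fin` start at `0`, so `ln (j + 1)` with `j ≥ 1` becomes
`log (j + 2)`. All suprema are over finite index sets (and are `0` if the set is empty). -/
noncomputable def D3 {m n : ℕ} {Ω : Type*} [MeasurableSpace Ω] (p q : ℝ≥0∞)
    (A : Matrix (Fin m) (Fin n) ℝ) (g : Fin m → Fin n → Ω → ℝ) (μ : Measure Ω) : ℝ :=
  if p ≤ 2 ∧ 2 ≤ q then ∫ ω, ⨆ ij : Fin m × Fin n, |A ij.1 ij.2 * g ij.1 ij.2 ω| ∂μ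
  else if p ≤ q ∧ q ≤ 2 then
    ⨆ j : Fin n, √(Real.log ((j : ℝ) + 2)) * decrRearr (colNorm q A) j
  else if 2 ≤ p ∧ p ≤ q then
    ⨆ i : Fin m, √(Real.log ((i : ℝ) + 2)) * decrRearr (rowNorm p A) i
  else 0

/-! Write N_p(b) for `diagNorm p b`, the supremum of |(b_j t_j)|_2 over the unit ball of ℓ_p. For a
tensor the matrix of squares has rank one, so D₁ = ‖a‖_q N_p(b) (`D1_eq_of_tensor`). Transposition
with conjugate exponents preserves the operator norm and exchanges D₁ with D₂, so D₂ = ‖b‖_{p*}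
N_{q*}(a).

Upper bound: the norm is the supremum of the Gaussian process Σ s_i t_j a_i b_j g_ij over a product
of two balls. The variances of its increments are at most those of √2 (N_p(b) Σ a_i s_i h_i +
N_{q*}(a) Σ b_j t_j h'_j), so the Sudakov–Fernique inequality yields Chevet's inequality (`chevet`):
E‖G_A‖ ≤ √2 (N_p(b) E‖(a_i h_i)‖_q + N_{q*}(a) E‖(b_j h'_j)‖_{p*}). For q < ∞ the first expectation
is at most 2√q ‖a‖_q, which produces D₁. For q = ∞ it is of order max √(ln(i+1)) a_i^*, and its
product with N_p(b) is controlled by D₃. The second term is treated in the same way with p*, the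
exceptional case being p = 1.

Lower bound: at a fixed t the vector G_A t is |(b_j t_j)|_2 (a_i h_i) with iid standard Gaussian
h_i. The supremum over t, taken outside the expectation, dominates D₁ and, through the largest
coordinate, D₃ for 2 ≤ p ≤ q. Duality gives D₂ and the case p ≤ q ≤ 2. For p ≤ 2 ≤ q, D₃ is the
expected largest entry, which the norm dominates pointwise. -/

/-! ### Gaussian integration by parts. -/

/-- The standard Gaussian measure on `ι → ℝ`. -/
noncomputable abbrev gaussPi (ι : Type*) [Fintype ι] : Measure (ι → ℝ) :=
  Measure.pi fun _ : ι => gaussianReal 0 1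

lemma hasDerivAt_gaussianPDFReal_std (x : ℝ) :
    HasDerivAt (gaussianPDFReal 0 1) (-x * gaussianPDFReal 0 1 x) x := by
  have h : HasDerivAt (fun y : ℝ => -(y - 0) ^ 2 / (2 * ((1 : NNReal) : ℝ))) (-x) x :=
    ((((hasDerivAt_id x).sub_const 0).pow 2).neg.div_const (2 * ((1 : NNReal) : ℝ))).congr_deriv
      (by simp; ring)
  refine (h.exp.const_mul (√(2 * Real.pi * ((1 : NNReal) : ℝ)))⁻¹).congr_deriv ?_
  rw [gaussianPDFReal_def]; ring

lemma integrable_gaussianReal_iff_pdf {f : ℝ → ℝ} :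
    Integrable f (gaussianReal 0 1) ↔ Integrable (fun x => gaussianPDFReal 0 1 x * f x) := by
  rw [gaussianReal_of_var_ne_zero 0 one_ne_zero,
    integrable_withDensity_iff_integrable_smul' (measurable_gaussianPDF 0 1)
      (by simp [gaussianPDF_lt_top])]
  simp [toReal_gaussianPDF]

lemma integrable_id_gaussianReal_std : Integrable (fun x : ℝ => x) (gaussianReal 0 1) :=
  (memLp_id_gaussianReal (μ := 0) (v := 1) 1).integrable (by simp)

/-- Gaussian integration by parts on the line. -/
lemma integral_mul_gaussianReal_std {f f' : ℝ → ℝ} (hf : ∀ x, HasDerivAt f (f' x) x)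
    {C C' : ℝ} (hC : ∀ x, |f x| ≤ C) (hC' : ∀ x, |f' x| ≤ C') :
    ∫ x, x * f x ∂(gaussianReal 0 1) = ∫ x, f' x ∂(gaussianReal 0 1) := by
  have hfm : Measurable f :=
    (continuous_iff_continuousAt.2 fun x => (hf x).continuousAt).measurable
  have hf'm : Measurable f' := by
    have : f' = deriv f := funext fun x => (hf x).deriv.symm
    rw [this]; exact measurable_deriv f
  have i1 : Integrable (fun x => x * f x) (gaussianReal 0 1) := by
    refine integrable_id_gaussianReal_std.mul_bdd (c := C) hfm.aestronglyMeasurable ?_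
    exact .of_forall hC
  have i2 : Integrable f' (gaussianReal 0 1) :=
    Integrable.of_bound hf'm.aestronglyMeasurable C' (.of_forall hC')
  have i3 : Integrable f (gaussianReal 0 1) :=
    Integrable.of_bound hfm.aestronglyMeasurable C (.of_forall hC)
  rw [integrable_gaussianReal_iff_pdf] at i1 i2 i3
  rw [integral_gaussianReal_eq_integral_smul one_ne_zero,
    integral_gaussianReal_eq_integral_smul one_ne_zero]
  -- The density satisfies φ' = -xφ; integrability of φf', φ'f and φf makes the boundary terms
  -- vanish.
  have key := integral_mul_deriv_eq_deriv_mul_of_integrable (u := gaussianPDFReal 0 1)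
    (u' := fun x => -x * gaussianPDFReal 0 1 x) (v := f) (v' := f')
    (fun x _ => hasDerivAt_gaussianPDFReal_std x) (fun x _ => hf x) i2
    (by refine i1.neg.congr (.of_forall fun x => ?_); simp; ring) i3
  simp only [smul_eq_mul]
  rw [key, ← integral_neg]
  congr 1; ext x; ring

/-- Resampling one coordinate independently does not change a product measure. This isolates
coordinate `k` for Fubini without splitting the index type. -/
lemma measurePreserving_update {ι : Type*} [Fintype ι] [DecidableEq ι] (ν : Measure ℝ)
    [IsProbabilityMeasure ν] (k : ι) :
    MeasurePreserving (fun z : ℝ × (ι → ℝ) => Function.update z.2 k z.1)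
      (ν.prod (Measure.pi fun _ : ι => ν)) (Measure.pi fun _ : ι => ν) := by
  have hm : Measurable (fun z : ℝ × (ι → ℝ) => Function.update z.2 k z.1) := by
    refine measurable_pi_lambda _ fun i => ?_
    by_cases h : i = k
    · subst h; simpa using measurable_fst
    · simp only [Function.update_of_ne h]; fun_prop
  refine ⟨hm, ?_⟩
  refine (Measure.pi_eq fun s hs => ?_).symm
  rw [Measure.map_apply hm (MeasurableSet.univ_pi hs)]
  have : (fun z : ℝ × (ι → ℝ) => Function.update z.2 k z.1) ⁻¹' (Set.univ.pi s)
      = s k ×ˢ (Set.univ.pi (Function.update s k Set.univ)) := by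
    ext ⟨x, g⟩
    simp only [Set.mem_preimage, Set.mem_pi, Set.mem_univ, true_implies, Set.mem_prod]
    constructor
    · intro h
      refine ⟨by simpa using h k, fun i => ?_⟩
      by_cases hi : i = k
      · subst hi; simp
      · simpa [Function.update_of_ne hi] using h i
    · rintro ⟨h1, h2⟩ i
      by_cases hi : i = k
      · subst hi; simpa using h1
      · simpa [Function.update_of_ne hi] using h2 i
  rw [this, Measure.prod_prod, Measure.pi_pi, ← Finset.mul_prod_erase _ _ (Finset.mem_univ k),
    ← Finset.mul_prod_erase _ (fun i => ν (s i)) (Finset.mem_univ k)]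
  simp only [Function.update_self, measure_univ, one_mul]
  congr 1
  refine Finset.prod_congr rfl fun i hi => ?_
  rw [Function.update_of_ne (Finset.ne_of_mem_erase hi)]

lemma integrable_eval_gaussPi {ι : Type*} [Fintype ι] (k : ι) :
    Integrable (fun g : ι → ℝ => g k) (gaussPi ι) :=
  (measurePreserving_eval (fun _ : ι => gaussianReal 0 1) k).integrable_comp_of_integrable
    integrable_id_gaussianReal_std

/-- Gaussian integration by parts in one coordinate of a product. -/
lemma integral_eval_mul_gaussPi {ι : Type*} [Fintype ι] [DecidableEq ι] (k : ι)
    {f f' : (ι → ℝ) → ℝ} (hfm : Measurable f) (hf'm : Measurable f')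
    (hf : ∀ g x, HasDerivAt (fun y => f (Function.update g k y)) (f' (Function.update g k x)) x)
    {C C' : ℝ} (hC : ∀ x, |f x| ≤ C) (hC' : ∀ x, |f' x| ≤ C') :
    ∫ g, g k * f g ∂(gaussPi ι) = ∫ g, f' g ∂(gaussPi ι) := by
  have mp := measurePreserving_update (gaussianReal 0 1) k
  have i1 : Integrable (fun g : ι → ℝ => g k * f g) (gaussPi ι) :=
    (integrable_eval_gaussPi k).mul_bdd (c := C) hfm.aestronglyMeasurable (.of_forall hC)
  have i2 : Integrable f' (gaussPi ι) :=
    Integrable.of_bound hf'm.aestronglyMeasurable C' (.of_forall hC')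
  have j1 := mp.integrable_comp_of_integrable i1
  have j2 := mp.integrable_comp_of_integrable i2
  have tr : ∀ F : (ι → ℝ) → ℝ, Integrable F (gaussPi ι) → ∫ g, F g ∂(gaussPi ι)
      = ∫ z : ℝ × (ι → ℝ), F (Function.update z.2 k z.1)
        ∂((gaussianReal 0 1).prod (gaussPi ι)) := fun F hF => by
    rw [← integral_map mp.aemeasurable (by rw [mp.map_eq]; exact hF.aestronglyMeasurable),
      mp.map_eq]
  rw [tr _ i1, tr _ i2]
  -- The other coordinates are frozen in the outer integral, so the inner one is the identity on the
  -- line.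
  refine (integral_prod_symm _ j1).trans ((?_ : _ = _).trans (integral_prod_symm _ j2).symm)
  refine integral_congr_ae (.of_forall fun g => ?_)
  simp only [Function.comp_def, Function.update_self]
  exact integral_mul_gaussianReal_std (hf g) (fun x => hC _) (fun x => hC' _)

/-! ### The soft maximum and its gradient. -/

section SoftMax

variable {T : Type*} [Fintype T]

/-- The log-sum-exp function. -/
noncomputable def logSumExp (z : T → ℝ) : ℝ := Real.log (∑ t, Real.exp (z t))

/-- The gradient of `logSumExp`. -/
noncomputable def softMax (z : T → ℝ) (t : T) : ℝ := Real.exp (z t) / ∑ s, Real.exp (z s)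

lemma sum_exp_pos [Nonempty T] (z : T → ℝ) : 0 < ∑ s, Real.exp (z s) :=
  Finset.sum_pos (fun _ _ => Real.exp_pos _) Finset.univ_nonempty

lemma softMax_nonneg (z : T → ℝ) (t : T) : 0 ≤ softMax z t := by
  unfold softMax; positivity

lemma sum_softMax [Nonempty T] (z : T → ℝ) : ∑ t, softMax z t = 1 := by
  simp only [softMax, ← Finset.sum_div]
  exact div_self (sum_exp_pos z).ne'

lemma softMax_le_one [Nonempty T] (z : T → ℝ) (t : T) : softMax z t ≤ 1 := by
  rw [← sum_softMax z]
  exact Finset.single_le_sum (f := softMax z) (fun s _ => softMax_nonneg z s) (Finset.mem_univ t)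

lemma abs_softMax_le_one [Nonempty T] (z : T → ℝ) (t : T) : |softMax z t| ≤ 1 := by
  rw [abs_of_nonneg (softMax_nonneg z t)]; exact softMax_le_one z t

lemma hasDerivAt_logSumExp [Nonempty T] {z : ℝ → T → ℝ} {z' : T → ℝ} {x : ℝ}
    (hz : ∀ t, HasDerivAt (fun y => z y t) (z' t) x) :
    HasDerivAt (fun y => logSumExp (z y)) (∑ t, softMax (z x) t * z' t) x := by
  have h1 : HasDerivAt (fun y => ∑ t, Real.exp (z y t)) (∑ t, Real.exp (z x t) * z' t) x :=
    HasDerivAt.fun_sum fun t _ => (hz t).exp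
  refine (h1.log (sum_exp_pos (z x)).ne').congr_deriv ?_
  rw [Finset.sum_div]
  exact Finset.sum_congr rfl fun t _ => by rw [softMax]; ring

lemma hasDerivAt_softMax [Nonempty T] {z : ℝ → T → ℝ} {z' : T → ℝ} {x : ℝ}
    (hz : ∀ t, HasDerivAt (fun y => z y t) (z' t) x) (t : T) :
    HasDerivAt (fun y => softMax (z y) t)
      (softMax (z x) t * (z' t - ∑ s, softMax (z x) s * z' s)) x := by
  have h1 : HasDerivAt (fun y => ∑ t, Real.exp (z y t)) (∑ t, Real.exp (z x t) * z' t) x :=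
    HasDerivAt.fun_sum fun t _ => (hz t).exp
  have hp := (sum_exp_pos (z x)).ne'
  refine ((hz t).exp.fun_div h1 hp).congr_deriv ?_
  have : ∑ s, softMax (z x) s * z' s
      = (∑ s, Real.exp (z x s) * z' s) / ∑ s, Real.exp (z x s) := by
    rw [Finset.sum_div]
    exact Finset.sum_congr rfl fun t _ => by rw [softMax]; ring
  rw [this, softMax]
  field_simp

lemma le_logSumExp (z : T → ℝ) (t : T) : z t ≤ logSumExp z := by
  have : Nonempty T := ⟨t⟩
  rw [logSumExp, Real.le_log_iff_exp_le (sum_exp_pos z)]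
  exact Finset.single_le_sum (f := fun s => Real.exp (z s)) (fun s _ => (Real.exp_pos _).le)
    (Finset.mem_univ t)

lemma le_iSup_fintype (z : T → ℝ) (t : T) : z t ≤ ⨆ s, z s :=
  le_ciSup (Set.finite_range z).bddAbove t

/-- Together with `le_logSumExp`, this keeps the soft maximum within the logarithm of the
cardinality of the true one, an error that does not grow when `z` is scaled. -/
lemma logSumExp_le [Nonempty T] (z : T → ℝ) :
    logSumExp z ≤ (⨆ t, z t) + Real.log (Fintype.card T) := by
  have hc : (0 : ℝ) < Fintype.card T := by exact_mod_cast Fintype.card_pos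
  rw [logSumExp, Real.log_le_iff_le_exp (sum_exp_pos z), Real.exp_add, Real.exp_log hc]
  calc ∑ t, Real.exp (z t) ≤ ∑ _t : T, Real.exp (⨆ t, z t) :=
        Finset.sum_le_sum fun t _ => Real.exp_le_exp.2 (le_iSup_fintype z t)
    _ = _ := by simp [mul_comm]

lemma measurable_softMax (t : T) : Measurable fun z : T → ℝ => softMax z t := by
  unfold softMax; fun_prop

lemma measurable_logSumExp : Measurable fun z : T → ℝ => logSumExp z := by
  unfold logSumExp; fun_prop

lemma abs_logSumExp_le [Nonempty T] (z : T → ℝ) :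
    |logSumExp z| ≤ ∑ t, |z t| + Real.log (Fintype.card T) := by
  have hc : 0 ≤ Real.log (Fintype.card T) :=
    Real.log_nonneg (by exact_mod_cast Fintype.card_pos)
  have hs : ∀ t, |z t| ≤ ∑ t, |z t| := fun t =>
    Finset.single_le_sum (f := fun s => |z s|) (fun s _ => abs_nonneg _) (Finset.mem_univ t)
  rw [abs_le]
  constructor
  · have t := Classical.arbitrary T
    have := le_logSumExp z t
    have := hs t
    have := neg_abs_le (z t)
    linarith
  · refine (logSumExp_le z).trans ?_
    gcongr
    exact ciSup_le fun t => (le_abs_self _).trans (hs t)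

end SoftMax

set_option linter.unusedSectionVars false

/-! ### Comparison of expected maxima of Gaussian families. -/

section SudakovFernique

variable {T : Type*} [Fintype T] {J : Type*} [Fintype J]

/-- The linear forms with coefficient vectors `u t`, at `g`. -/
def linForms (u : T → J → ℝ) (g : J → ℝ) (t : T) : ℝ := ∑ k, u t k * g k

lemma measurable_linForms (u : T → J → ℝ) : Measurable (linForms u) := by
  unfold linForms; fun_prop

lemma integrable_linForms (u : T → J → ℝ) (t : T) :
    Integrable (fun g => linForms u g t) (gaussPi J) :=
  integrable_finsetSum _ fun k _ => (integrable_eval_gaussPi k).const_mul _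

lemma integrable_iSup_linForms (u : T → J → ℝ) :
    Integrable (fun g => ⨆ t, linForms u g t) (gaussPi J) := by
  cases isEmpty_or_nonempty T
  · simp
  have hm : Measurable fun g => ⨆ t, linForms u g t :=
    Measurable.iSup fun t => (measurable_pi_apply t).comp (measurable_linForms u)
  refine Integrable.mono' (g := fun g => ∑ t, |linForms u g t|)
    (integrable_finsetSum _ fun t _ => (integrable_linForms u t).abs)
    hm.aestronglyMeasurable (.of_forall fun g => ?_)
  have hs : ∀ t, |linForms u g t| ≤ ∑ t, |linForms u g t| := fun t =>
    Finset.single_le_sum (f := fun s => |linForms u g s|) (fun s _ => abs_nonneg _)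
      (Finset.mem_univ t)
  rw [Real.norm_eq_abs, abs_le]
  constructor
  · have t := Classical.arbitrary T
    have h1 := le_iSup_fintype (linForms u g) t
    have := hs t
    have := neg_abs_le (linForms u g t)
    linarith
  · exact ciSup_le fun t => (le_abs_self _).trans (hs t)

lemma integrable_logSumExp_linForms [Nonempty T] (u : T → J → ℝ) :
    Integrable (fun g => logSumExp (linForms u g)) (gaussPi J) := by
  refine Integrable.mono' (g := fun g => ∑ t, |linForms u g t| + Real.log (Fintype.card T))
    ((integrable_finsetSum _ fun t _ => (integrable_linForms u t).abs).add (integrable_const _))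
    (measurable_logSumExp.comp (measurable_linForms u)).aestronglyMeasurable
    (.of_forall fun g => ?_)
  exact abs_logSumExp_le _

lemma linForms_update [DecidableEq J] (u : T → J → ℝ) (g : J → ℝ) (k : J) (x : ℝ) (t : T) :
    HasDerivAt (fun y => linForms u (Function.update g k y) t) (u t k) x := by
  have : ∀ l ∈ Finset.univ, HasDerivAt (fun y => u t l * Function.update g k y l)
      (if l = k then u t k else 0) x := by
    intro l _
    by_cases h : l = k
    · subst h
      simpa using (hasDerivAt_id x).const_mul (u t l)
    · simpa [Function.update_of_ne h, h] using hasDerivAt_const x (u t l * g l)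
  simpa [linForms] using HasDerivAt.fun_sum this

/-- Gaussian integration by parts for the gradient of the soft maximum of linear forms. -/
lemma integral_eval_mul_softMax [Nonempty T] (u : T → J → ℝ) (k : J) (t : T) :
    ∫ g, g k * softMax (linForms u g) t ∂(gaussPi J)
      = ∫ g, softMax (linForms u g) t *
          (u t k - ∑ s, softMax (linForms u g) s * u s k) ∂(gaussPi J) := by
  classical
  have hm : ∀ t, Measurable fun g => softMax (linForms u g) t := fun t =>
    (measurable_softMax t).comp (measurable_linForms u)
  refine integral_eval_mul_gaussPi k (f := fun g => softMax (linForms u g) t)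
    (f' := fun g => softMax (linForms u g) t *
          (u t k - ∑ s, softMax (linForms u g) s * u s k)) (hm t)
    ((hm t).mul (measurable_const.sub (Finset.measurable_sum _ fun s _ =>
      (hm s).mul_const _))) (fun g x => ?_) (C := 1) (fun g => abs_softMax_le_one _ t)
    (C' := |u t k| + ∑ s, |u s k|) (fun g => ?_)
  · exact hasDerivAt_softMax (z' := fun t => u t k) (fun t => linForms_update u g k x t) t
  · rw [abs_mul]
    refine (mul_le_of_le_one_left (abs_nonneg _) (abs_softMax_le_one _ t)).trans ?_
    refine (abs_sub _ _).trans (add_le_add le_rfl ?_)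
    refine (Finset.abs_sum_le_sum_abs _ _).trans (Finset.sum_le_sum fun s _ => ?_)
    rw [abs_mul]
    exact mul_le_of_le_one_left (abs_nonneg _) (abs_softMax_le_one _ s)

/-- Since the weights sum to 1, centring `u t` means averaging the differences `u t - u s`;
exchanging `t` and `s` and taking the mean symmetrizes `v` as well. Thus only increments enter the
derivative along the interpolation. -/
lemma sum_softMax_identity [Nonempty T] (p : T → ℝ) (hp : ∑ t, p t = 1) (u v : T → J → ℝ) :
    ∑ t, ∑ k, v t k * (p t * (u t k - ∑ s, p s * u s k))
      = 2⁻¹ * ∑ t, ∑ s, p t * p s * ∑ k, (v t k - v s k) * (u t k - u s k) := by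
  have e1 : ∀ t k, u t k - ∑ s, p s * u s k = ∑ s, p s * (u t k - u s k) := by
    intro t k
    simp only [mul_sub, Finset.sum_sub_distrib, ← Finset.sum_mul, hp, one_mul]
  have e2 : ∑ t, ∑ k, v t k * (p t * (u t k - ∑ s, p s * u s k))
      = ∑ t, ∑ s, p t * p s * ∑ k, v t k * (u t k - u s k) := by
    refine Finset.sum_congr rfl fun t _ => ?_
    simp only [e1, Finset.mul_sum]
    rw [Finset.sum_comm]
    exact Finset.sum_congr rfl fun s _ => Finset.sum_congr rfl fun k _ => by ring
  have e3 : ∑ t, ∑ s, p t * p s * ∑ k, v t k * (u t k - u s k)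
      = ∑ t, ∑ s, p t * p s * ∑ k, v s k * (u s k - u t k) := by
    rw [Finset.sum_comm]
    exact Finset.sum_congr rfl fun s _ => Finset.sum_congr rfl fun k _ => by ring
  have e4 : ∑ t, ∑ s, p t * p s * ∑ k, (v t k - v s k) * (u t k - u s k)
      = ∑ t, ∑ s, p t * p s * ∑ k, v t k * (u t k - u s k)
        + ∑ t, ∑ s, p t * p s * ∑ k, v s k * (u s k - u t k) := by
    simp only [← Finset.sum_add_distrib, ← mul_add]
    exact Finset.sum_congr rfl fun t _ => Finset.sum_congr rfl fun s _ => by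
      congr 1; exact Finset.sum_congr rfl fun k _ => by ring
  rw [e4, ← e3, e2]; ring

/-- The derivative of the expected soft maximum along a smooth family of linear forms. -/
lemma hasDerivAt_integral_logSumExp [Nonempty T] {u v : ℝ → T → J → ℝ}
    (hu : ∀ θ t k, HasDerivAt (fun y => u y t k) (v θ t k) θ) {K : ℝ}
    (hK : ∀ θ t k, |v θ t k| ≤ K) (θ : ℝ) :
    HasDerivAt (fun y => ∫ g, logSumExp (linForms (u y) g) ∂(gaussPi J))
      (2⁻¹ * ∫ g, ∑ t, ∑ s, softMax (linForms (u θ) g) t * softMax (linForms (u θ) g) s *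
        ∑ k, (v θ t k - v θ s k) * (u θ t k - u θ s k) ∂(gaussPi J)) θ := by
  have hm : ∀ t, Measurable fun g => softMax (linForms (u θ) g) t := fun t =>
    (measurable_softMax t).comp (measurable_linForms _)
  have hd : ∀ g y, HasDerivAt (fun y => logSumExp (linForms (u y) g))
      (∑ t, softMax (linForms (u y) g) t * linForms (v y) g t) y := fun g y =>
    hasDerivAt_logSumExp (z := fun y => linForms (u y) g) fun t =>
      HasDerivAt.fun_sum fun k _ => (hu y t k).mul_const (g k)
  have key := (hasDerivAt_integral_of_dominated_loc_of_deriv_le (μ := gaussPi J)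
    (F := fun y g => logSumExp (linForms (u y) g))
    (F' := fun y g => ∑ t, softMax (linForms (u y) g) t * linForms (v y) g t)
    (x₀ := θ) (s := Set.univ) (bound := fun g => ∑ _t : T, ∑ k, K * |g k|)
    Filter.univ_mem
    (.of_forall fun y => (integrable_logSumExp_linForms (u y)).aestronglyMeasurable)
    (integrable_logSumExp_linForms (u θ))
    (Measurable.aestronglyMeasurable <| Finset.measurable_sum _ fun t _ =>
      (hm t).mul ((measurable_pi_apply t).comp (measurable_linForms _)))
    (.of_forall fun g y _ => ?_)
    (integrable_finsetSum _ fun t _ => integrable_finsetSum _ fun k _ =>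
      (integrable_eval_gaussPi k).abs.const_mul K)
    (.of_forall fun g y _ => hd g y)).2
  · refine key.congr_deriv (Eq.symm ?_)
    have hi : ∀ t k, Integrable (fun g => g k * softMax (linForms (u θ) g) t) (gaussPi J) :=
      fun t k => (integrable_eval_gaussPi k).mul_bdd (c := 1) (hm t).aestronglyMeasurable
        (.of_forall fun g => abs_softMax_le_one _ t)
    have hi2 : ∀ t k, Integrable (fun g => softMax (linForms (u θ) g) t *
          (u θ t k - ∑ s, softMax (linForms (u θ) g) s * u θ s k)) (gaussPi J) := by
      intro t k
      have b : ∀ (f : (J → ℝ) → ℝ), Integrable f (gaussPi J) → ∀ t,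
          Integrable (fun g => softMax (linForms (u θ) g) t * f g) (gaussPi J) := fun f hf t =>
        hf.bdd_mul (c := 1) (hm t).aestronglyMeasurable (.of_forall fun g => abs_softMax_le_one _ t)
      exact b _ ((integrable_const _).sub (integrable_finsetSum _ fun s _ =>
        b _ (integrable_const _) s)) t
    -- Read upwards, integration by parts trades each factor `g k` for a derivative of the soft
    -- maximum's gradient.
    calc _ = ∫ g, ∑ t, ∑ k, v θ t k * (softMax (linForms (u θ) g) t *
          (u θ t k - ∑ s, softMax (linForms (u θ) g) s * u θ s k)) ∂(gaussPi J) := by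
          rw [← integral_const_mul]
          refine integral_congr_ae (.of_forall fun g => ?_)
          exact (sum_softMax_identity _ (sum_softMax _) _ _).symm
      _ = ∫ g, ∑ t, ∑ k, v θ t k * (g k * softMax (linForms (u θ) g) t) ∂(gaussPi J) := by
          rw [integral_finsetSum _ fun t _ => integrable_finsetSum _ fun k _ =>
              (hi2 t k).const_mul _,
            integral_finsetSum _ fun t _ => integrable_finsetSum _ fun k _ =>
              (hi t k).const_mul _]
          refine Finset.sum_congr rfl fun t _ => ?_
          rw [integral_finsetSum _ fun k _ => (hi2 t k).const_mul _,
            integral_finsetSum _ fun k _ => (hi t k).const_mul _]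
          refine Finset.sum_congr rfl fun k _ => ?_
          rw [integral_const_mul, integral_const_mul, integral_eval_mul_softMax]
      _ = _ := by
          refine integral_congr_ae (.of_forall fun g => ?_)
          refine Finset.sum_congr rfl fun t _ => ?_
          rw [linForms, Finset.mul_sum]
          exact Finset.sum_congr rfl fun k _ => by ring
  · rw [Real.norm_eq_abs]
    refine (Finset.abs_sum_le_sum_abs _ _).trans (Finset.sum_le_sum fun t _ => ?_)
    rw [abs_mul]
    refine (mul_le_of_le_one_left (abs_nonneg _) (abs_softMax_le_one _ t)).trans ?_
    refine (Finset.abs_sum_le_sum_abs _ _).trans (Finset.sum_le_sum fun k _ => ?_)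
    rw [abs_mul]
    exact mul_le_mul_of_nonneg_right (hK y t k) (abs_nonneg _)

/-- The comparison of expected soft maxima of two orthogonal Gaussian families. -/
lemma integral_logSumExp_le_of_dist_le [Nonempty T] {x y : T → J → ℝ}
    (hxy : ∀ t s, ∑ k, x t k * y s k = 0)
    (h : ∀ t s, ∑ k, (x t k - x s k) ^ 2 ≤ ∑ k, (y t k - y s k) ^ 2) :
    ∫ g, logSumExp (linForms x g) ∂(gaussPi J) ≤ ∫ g, logSumExp (linForms y g) ∂(gaussPi J) := by
  -- The interpolation from `x` to `y` is a rotation, so its velocity stays bounded up to both ends.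
  set u : ℝ → T → J → ℝ := fun θ t k => Real.cos θ * x t k + Real.sin θ * y t k with hu_def
  set v : ℝ → T → J → ℝ := fun θ t k => -Real.sin θ * x t k + Real.cos θ * y t k with hv_def
  have hu : ∀ θ t k, HasDerivAt (fun y => u y t k) (v θ t k) θ := fun θ t k =>
    ((Real.hasDerivAt_cos θ).mul_const _).add ((Real.hasDerivAt_sin θ).mul_const _)
  have hK : ∀ θ t k, |v θ t k| ≤ ∑ t, ∑ k, (|x t k| + |y t k|) := by
    intro θ t k
    have h1 : |v θ t k| ≤ |x t k| + |y t k| := by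
      refine (abs_add_le _ _).trans (add_le_add ?_ ?_)
      · rw [abs_mul, abs_neg]
        exact mul_le_of_le_one_left (abs_nonneg _) (Real.abs_sin_le_one θ)
      · rw [abs_mul]
        exact mul_le_of_le_one_left (abs_nonneg _) (Real.abs_cos_le_one θ)
    refine h1.trans ?_
    refine (Finset.single_le_sum (f := fun k => |x t k| + |y t k|) (fun k _ => by positivity)
      (Finset.mem_univ k)).trans ?_
    exact Finset.single_le_sum (f := fun t => ∑ k, (|x t k| + |y t k|))
      (fun k _ => by positivity) (Finset.mem_univ t)
  have hder := hasDerivAt_integral_logSumExp hu hK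
  set Φ := fun θ => ∫ g, logSumExp (linForms (u θ) g) ∂(gaussPi J) with hΦ
  have hmono : MonotoneOn Φ (Set.Icc 0 (Real.pi / 2)) := by
    refine monotoneOn_of_deriv_nonneg (convex_Icc _ _)
      (fun θ _ => (hder θ).continuousAt.continuousWithinAt)
      (fun θ _ => (hder θ).differentiableAt.differentiableWithinAt) fun θ hθ => ?_
    rw [interior_Icc] at hθ
    rw [(hder θ).deriv]
    refine mul_nonneg (by norm_num) (integral_nonneg fun g => ?_)
    refine Finset.sum_nonneg fun t _ => Finset.sum_nonneg fun s _ =>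
      mul_nonneg (mul_nonneg (softMax_nonneg _ _) (softMax_nonneg _ _)) ?_
    -- Orthogonality removes the cross terms, leaving sin θ cos θ times the difference of squared
    -- increments, which is nonnegative on the quarter circle.
    have e : ∑ k, (v θ t k - v θ s k) * (u θ t k - u θ s k)
        = Real.sin θ * Real.cos θ *
          (∑ k, (y t k - y s k) ^ 2 - ∑ k, (x t k - x s k) ^ 2)
          + (Real.cos θ ^ 2 - Real.sin θ ^ 2) *
            (∑ k, x t k * y t k - ∑ k, x t k * y s k - ∑ k, x s k * y t k
              + ∑ k, x s k * y s k) := by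
      simp only [hu_def, hv_def, mul_sub, mul_add, Finset.mul_sum, ← Finset.sum_sub_distrib,
        ← Finset.sum_add_distrib]
      exact Finset.sum_congr rfl fun k _ => by ring
    rw [e]
    simp only [hxy, sub_zero, add_zero, mul_zero]
    have := Real.sin_nonneg_of_nonneg_of_le_pi hθ.1.le (by linarith [hθ.2, Real.pi_pos])
    have := Real.cos_nonneg_of_neg_pi_div_two_le_of_le (x := θ)
      (by linarith [hθ.1, Real.pi_pos]) hθ.2.le
    have := sub_nonneg.2 (h t s)
    positivity
  have hle := hmono (Set.left_mem_Icc.2 (by positivity)) (Set.right_mem_Icc.2 (by positivity))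
    (by positivity : (0 : ℝ) ≤ Real.pi / 2)
  have h0 : u 0 = x := by ext t k; simp [hu_def]
  have h1 : u (Real.pi / 2) = y := by ext t k; simp [hu_def]
  simpa only [hΦ, h0, h1] using hle

/-- **Sudakov–Fernique inequality** for finite families spanning orthogonal spaces. -/
theorem sudakov_fernique [Nonempty T] {x y : T → J → ℝ}
    (hxy : ∀ t s, ∑ k, x t k * y s k = 0)
    (h : ∀ t s, ∑ k, (x t k - x s k) ^ 2 ≤ ∑ k, (y t k - y s k) ^ 2) :
    ∫ g, ⨆ t, linForms x g t ∂(gaussPi J) ≤ ∫ g, ⨆ t, linForms y g t ∂(gaussPi J) := by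
  set L := Real.log (Fintype.card T)
  have hL : 0 ≤ L := Real.log_nonneg (by exact_mod_cast Fintype.card_pos)
  -- Scaling both families by β keeps the additive error at `L`, so relative to β it disappears as β
  -- grows.
  have hβ : ∀ β : ℝ, 0 < β → β * ∫ g, ⨆ t, linForms x g t ∂(gaussPi J)
      ≤ β * ∫ g, ⨆ t, linForms y g t ∂(gaussPi J) + L := by
    intro β hβ
    have es : ∀ (z : T → J → ℝ) g t,
        linForms (fun t k => β * z t k) g t = β * linForms z g t := by
      intro z g t
      simp only [linForms, Finset.mul_sum, mul_assoc]
    have key := integral_logSumExp_le_of_dist_le (x := fun t k => β * x t k)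
      (y := fun t k => β * y t k) (fun t s => by
        have : ∀ k, β * x t k * (β * y s k) = β ^ 2 * (x t k * y s k) := fun k => by ring
        simp only [this, ← Finset.mul_sum, hxy, mul_zero]) (fun t s => by
        simp only [← mul_sub, mul_pow, ← Finset.mul_sum]
        exact mul_le_mul_of_nonneg_left (h t s) (sq_nonneg β))
    calc β * ∫ g, ⨆ t, linForms x g t ∂(gaussPi J)
        = ∫ g, β * ⨆ t, linForms x g t ∂(gaussPi J) := (integral_const_mul _ _).symm
      _ ≤ ∫ g, logSumExp (linForms (fun t k => β * x t k) g) ∂(gaussPi J) := by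
          refine integral_mono ((integrable_iSup_linForms x).const_mul β)
            (integrable_logSumExp_linForms _) fun g => ?_
          simp only
          rw [Real.mul_iSup_of_nonneg hβ.le]
          refine ciSup_le fun t => ?_
          rw [← es]; exact le_logSumExp _ t
      _ ≤ ∫ g, logSumExp (linForms (fun t k => β * y t k) g) ∂(gaussPi J) := key
      _ ≤ ∫ g, (β * ⨆ t, linForms y g t) + L ∂(gaussPi J) := by
          refine integral_mono (integrable_logSumExp_linForms _)
            (((integrable_iSup_linForms y).const_mul β).add (integrable_const _)) fun g => ?_
          simp only
          rw [Real.mul_iSup_of_nonneg hβ.le]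
          refine (logSumExp_le _).trans_eq ?_
          simp only [es]; rfl
      _ = _ := by
          rw [integral_add ((integrable_iSup_linForms y).const_mul β) (integrable_const _),
            integral_const_mul]
          simp
  refine le_of_forall_pos_le_add fun ε hε => ?_
  have := mul_le_mul_of_nonneg_right (hβ ((L + 1) / ε) (by positivity)) hε.le
  rw [add_mul, mul_right_comm, mul_right_comm _ _ ε, div_mul_cancel₀ _ hε.ne'] at this
  have h2 : (L + 1) * ∫ g, ⨆ t, linForms x g t ∂(gaussPi J)
      ≤ (L + 1) * (∫ g, ⨆ t, linForms y g t ∂(gaussPi J) + ε) := by nlinarith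
  exact le_of_mul_le_mul_left h2 (by positivity)

end SudakovFernique

/-! ### Norms and quasi-norms on ℝᵏ, Hölder duality. -/

section EllNorm

variable {k : ℕ}

lemma ellNorm_top (x : Fin k → ℝ) : ellNorm ∞ x = ⨆ i, |x i| :=
  PiLp.norm_eq_ciSup _

lemma ellNorm_eq_sum {p : ℝ≥0∞} (hp : 0 < p) (hp' : p ≠ ∞) (x : Fin k → ℝ) :
    ellNorm p x = (∑ i, |x i| ^ p.toReal) ^ (1 / p.toReal) :=
  PiLp.norm_eq_sum (ENNReal.toReal_pos hp.ne' hp') _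

lemma ellNorm_nonneg {p : ℝ≥0∞} (hp : 0 < p) (x : Fin k → ℝ) : 0 ≤ ellNorm p x := by
  by_cases h : p = ∞
  · subst h; rw [ellNorm_top]; exact Real.iSup_nonneg fun i => abs_nonneg _
  · rw [ellNorm_eq_sum hp h]; positivity

lemma ellNorm_mono {p : ℝ≥0∞} (hp : 0 < p) {x y : Fin k → ℝ} (h : ∀ i, |x i| ≤ |y i|) :
    ellNorm p x ≤ ellNorm p y := by
  by_cases h' : p = ∞
  · subst h'; rw [ellNorm_top, ellNorm_top]
    exact ciSup_mono (Set.finite_range _).bddAbove h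
  · rw [ellNorm_eq_sum hp h', ellNorm_eq_sum hp h']
    have := ENNReal.toReal_pos hp.ne' h'
    exact Real.rpow_le_rpow (by positivity) (Finset.sum_le_sum fun i _ =>
      Real.rpow_le_rpow (abs_nonneg _) (h i) this.le) (by positivity)

lemma ellNorm_congr_abs {p : ℝ≥0∞} (hp : 0 < p) {x y : Fin k → ℝ} (h : ∀ i, |x i| = |y i|) :
    ellNorm p x = ellNorm p y :=
  le_antisymm (ellNorm_mono hp fun i => (h i).le) (ellNorm_mono hp fun i => (h i).ge)

lemma ellNorm_const_mul {p : ℝ≥0∞} (hp : 0 < p) (c : ℝ) (x : Fin k → ℝ) :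
    ellNorm p (fun i => c * x i) = |c| * ellNorm p x := by
  by_cases h : p = ∞
  · subst h
    simp only [ellNorm_top, abs_mul]
    exact (Real.mul_iSup_of_nonneg (abs_nonneg c) _).symm
  · have hp' := ENNReal.toReal_pos hp.ne' h
    simp only [ellNorm_eq_sum hp h, abs_mul]
    have : ∀ i, (|c| * |x i|) ^ p.toReal = |c| ^ p.toReal * |x i| ^ p.toReal := fun i =>
      Real.mul_rpow (abs_nonneg _) (abs_nonneg _)
    simp only [this, ← Finset.mul_sum]
    rw [Real.mul_rpow (by positivity) (by positivity), ← Real.rpow_mul (abs_nonneg _),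
      mul_one_div_cancel hp'.ne', Real.rpow_one]

lemma ellNorm_mul_const {p : ℝ≥0∞} (hp : 0 < p) (c : ℝ) (x : Fin k → ℝ) :
    ellNorm p (fun i => x i * c) = ellNorm p x * |c| := by
  simp only [mul_comm _ c, ellNorm_const_mul hp c x, mul_comm _ |c|]

lemma ellNorm_zero {p : ℝ≥0∞} (hp : 0 < p) : ellNorm p (0 : Fin k → ℝ) = 0 := by
  have h := ellNorm_const_mul hp 0 (0 : Fin k → ℝ)
  simp only [zero_mul, abs_zero] at h
  exact h

lemma ellNorm_add_le {p : ℝ≥0∞} (hp : 1 ≤ p) (x y : Fin k → ℝ) :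
    ellNorm p (fun i => x i + y i) ≤ ellNorm p x + ellNorm p y := by
  have : Fact (1 ≤ p) := ⟨hp⟩
  exact norm_add_le (WithLp.toLp p x) (WithLp.toLp p y)

lemma abs_le_ellNorm {p : ℝ≥0∞} (hp : 0 < p) (x : Fin k → ℝ) (i : Fin k) :
    |x i| ≤ ellNorm p x := by
  by_cases h : p = ∞
  · subst h; rw [ellNorm_top]; exact le_iSup_fintype (fun i => |x i|) i
  · rw [ellNorm_eq_sum hp h]
    have hp' := ENNReal.toReal_pos hp.ne' h
    calc |x i| = (|x i| ^ p.toReal) ^ (1 / p.toReal) := by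
          rw [← Real.rpow_mul (abs_nonneg _), mul_one_div_cancel hp'.ne', Real.rpow_one]
      _ ≤ _ := by
          gcongr
          exact Finset.single_le_sum (f := fun i => |x i| ^ p.toReal)
            (fun i _ => by positivity) (Finset.mem_univ i)

lemma ellNorm_top_le {p : ℝ≥0∞} (hp : 0 < p) (x : Fin k → ℝ) : ellNorm ∞ x ≤ ellNorm p x := by
  rw [ellNorm_top]
  exact Real.iSup_le (abs_le_ellNorm hp x) (ellNorm_nonneg hp x)

lemma ellNorm_single {p : ℝ≥0∞} (hp : 0 < p) (i : Fin k) (c : ℝ) :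
    ellNorm p (Pi.single i c) = |c| := by
  refine le_antisymm ?_ (by simpa using abs_le_ellNorm hp (Pi.single i c) i)
  by_cases h : p = ∞
  · subst h; rw [ellNorm_top]
    refine Real.iSup_le (fun j => ?_) (abs_nonneg c)
    by_cases hj : j = i
    · subst hj; simp
    · simp [hj]
  · have hp' := ENNReal.toReal_pos hp.ne' h
    rw [ellNorm_eq_sum hp h, Finset.sum_eq_single i]
    · rw [← Real.rpow_mul (abs_nonneg _), mul_one_div_cancel hp'.ne']; simp
    · intro j _ hj; simp [hj, hp'.ne']
    · simp

lemma ellNorm_sum_le {p : ℝ≥0∞} (hp : 1 ≤ p) {α : Type*} (s : Finset α) (f : α → Fin k → ℝ) :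
    ellNorm p (fun i => ∑ a ∈ s, f a i) ≤ ∑ a ∈ s, ellNorm p (f a) := by
  classical
  induction s using Finset.induction_on with
  | empty => simp; exact (ellNorm_zero (zero_lt_one.trans_le hp)).le
  | insert a s ha ih =>
    simp only [Finset.sum_insert ha]
    exact (ellNorm_add_le hp _ _).trans (add_le_add le_rfl ih)

lemma ellNorm_le_sum {p : ℝ≥0∞} (hp : 1 ≤ p) (x : Fin k → ℝ) : ellNorm p x ≤ ∑ i, |x i| := by
  have h0 : 0 < p := zero_lt_one.trans_le hp
  have h := ellNorm_sum_le hp Finset.univ (fun i => (Pi.single i (x i) : Fin k → ℝ))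
  simp only [ellNorm_single h0] at h
  convert h using 2
  ext j
  simp [Finset.sum_pi_single]

/-- This removes the halved exponents of D₁ and D₂, which may be less than 1 and then give only
quasi-norms. -/
lemma ellNorm_sq {p : ℝ≥0∞} (hp : 0 < p) (x : Fin k → ℝ) :
    ellNorm (p / 2) (fun i => x i ^ 2) = ellNorm p x ^ 2 := by
  by_cases h : p = ∞
  · subst h
    rw [ENNReal.top_div_of_ne_top (by simp), ellNorm_top, ellNorm_top]
    cases isEmpty_or_nonempty (Fin k)
    · simp
    obtain ⟨i, hi⟩ := exists_eq_ciSup_of_finite (f := fun i => |x i|)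
    refine le_antisymm (ciSup_le fun i => ?_) ?_
    · simp only [abs_pow]
      gcongr
      exact le_iSup_fintype (fun i => |x i|) i
    · rw [← hi]
      exact (abs_pow (x i) 2).symm.trans_le (le_iSup_fintype (fun i => |x i ^ 2|) i)
  · have hp' := ENNReal.toReal_pos hp.ne' h
    have h2 : p / 2 ≠ ∞ := (ENNReal.div_lt_top h (by simp)).ne
    rw [ellNorm_eq_sum (ENNReal.div_pos hp.ne' (by simp)) h2, ellNorm_eq_sum hp h,
      ENNReal.toReal_div, ENNReal.toReal_ofNat]
    have : ∀ i, |x i ^ 2| ^ (p.toReal / 2) = |x i| ^ p.toReal := fun i => by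
      rw [abs_pow, ← Real.rpow_natCast, ← Real.rpow_mul (abs_nonneg _)]
      congr 1; push_cast; ring
    simp only [this]
    rw [← Real.rpow_natCast, ← Real.rpow_mul (by positivity)]
    congr 1; push_cast; field_simp

/-- Hölder's inequality. -/
lemma abs_sum_mul_le_ellNorm (p q : ℝ≥0∞) [hpq : p.HolderConjugate q] (x y : Fin k → ℝ) :
    |∑ i, x i * y i| ≤ ellNorm p x * ellNorm q y := by
  have aux : ∀ x y : Fin k → ℝ, |∑ i, x i * y i| ≤ ellNorm ∞ x * ellNorm 1 y := by
    intro x y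
    rw [ellNorm_eq_sum (p := 1) one_pos (by simp)]
    simp only [ENNReal.toReal_one, Real.rpow_one, div_one, Finset.mul_sum]
    refine (Finset.abs_sum_le_sum_abs _ _).trans (Finset.sum_le_sum fun i _ => ?_)
    rw [abs_mul]
    exact mul_le_mul_of_nonneg_right (abs_le_ellNorm (by simp) x i) (abs_nonneg _)
  by_cases hp : p = ∞
  · subst hp
    obtain rfl : q = 1 := ENNReal.HolderConjugate.unique ∞ q 1
    exact aux x y
  by_cases hq : q = ∞
  · subst hq
    have := hpq.symm
    obtain rfl : p = 1 := ENNReal.HolderConjugate.unique ∞ p 1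
    simpa only [mul_comm] using aux y x
  have h0 : 0 < p := ENNReal.HolderConjugate.pos p q
  have h0' : 0 < q := by have := hpq.symm; exact ENNReal.HolderConjugate.pos q p
  have hr := ENNReal.HolderConjugate.toReal_of_ne_top hp hq
  rw [ellNorm_eq_sum h0 hp, ellNorm_eq_sum h0' hq]
  refine (Finset.abs_sum_le_sum_abs _ _).trans ?_
  simp only [abs_mul]
  simpa using Real.inner_le_Lp_mul_Lq Finset.univ (fun i => |x i|) (fun i => |y i|) hr

/-- Hölder's inequality is attained. -/
lemma exists_sum_mul_eq_ellNorm (p q : ℝ≥0∞) [hpq : p.HolderConjugate q] (x : Fin k → ℝ) :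
    ∃ y : Fin k → ℝ, ellNorm q y ≤ 1 ∧ ∑ i, x i * y i = ellNorm p x := by
  have h0 : 0 < p := ENNReal.HolderConjugate.pos p q
  have h0' : 0 < q := by have := hpq.symm; exact ENNReal.HolderConjugate.pos q p
  have hsign : ∀ a : ℝ, ∃ s : ℝ, |s| ≤ 1 ∧ a * s = |a| := by
    intro a
    rcases le_total 0 a with h | h
    · exact ⟨1, by simp, by rw [mul_one, abs_of_nonneg h]⟩
    · exact ⟨-1, by simp, by rw [abs_of_nonpos h]; ring⟩
  choose s hs1 hs2 using hsign
  suffices h : ∃ y : Fin k → ℝ, ellNorm q y ≤ 1 ∧ ∑ i, |x i| * y i = ellNorm p x by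
    obtain ⟨y, hy, hxy⟩ := h
    refine ⟨fun i => s (x i) * y i, (ellNorm_mono h0' fun i => ?_).trans hy, ?_⟩
    · rw [abs_mul]; exact mul_le_of_le_one_left (abs_nonneg _) (hs1 _)
    · rw [← hxy]
      exact Finset.sum_congr rfl fun i _ => by rw [← mul_assoc, hs2]
  by_cases hp : p = ∞
  · subst hp
    obtain rfl : q = 1 := ENNReal.HolderConjugate.unique ∞ q 1
    rw [ellNorm_top]
    cases isEmpty_or_nonempty (Fin k)
    · exact ⟨0, by rw [ellNorm_zero one_pos]; exact zero_le_one, by simp⟩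
    obtain ⟨i, hi⟩ := exists_eq_ciSup_of_finite (f := fun i => |x i|)
    exact ⟨Pi.single i 1, by rw [ellNorm_single one_pos]; simp, by simp [← hi, Pi.single_apply]⟩
  by_cases hq : q = ∞
  · subst hq
    have := hpq.symm
    obtain rfl : p = 1 := ENNReal.HolderConjugate.unique ∞ p 1
    refine ⟨fun _ => 1, ?_, ?_⟩
    · rw [ellNorm_top]; exact Real.iSup_le (fun _ => by simp) zero_le_one
    · rw [ellNorm_eq_sum one_pos (by simp)]; simp
  have hr := ENNReal.HolderConjugate.toReal_of_ne_top hp hq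
  obtain ⟨⟨g, hg, hfg⟩, -⟩ := NNReal.isGreatest_Lp Finset.univ (fun i => ‖x i‖₊) hr
  refine ⟨fun i => g i, ?_, ?_⟩
  · rw [ellNorm_eq_sum h0' hq]
    refine Real.rpow_le_one (by positivity) ?_ (by positivity)
    simp only [NNReal.abs_eq]
    exact_mod_cast hg
  · rw [ellNorm_eq_sum h0 hp]
    have := congrArg NNReal.toReal hfg
    push_cast at this
    simpa using this

end EllNorm

/-! ### Operator norms of matrices. -/

section EllOpNorm

variable {m n : ℕ}

instance {ρ : ℝ≥0∞} {k : ℕ} [hρ : Fact (0 < ρ)] :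
    Nonempty {t : Fin k → ℝ // ellNorm ρ t ≤ 1} :=
  ⟨⟨0, by rw [ellNorm_zero hρ.out]; exact zero_le_one⟩⟩

lemma abs_mulVec_le {ρ : ℝ≥0∞} (hρ : 0 < ρ) (X : Matrix (Fin m) (Fin n) ℝ) {t : Fin n → ℝ}
    (ht : ellNorm ρ t ≤ 1) (i : Fin m) : |X.mulVec t i| ≤ ∑ j, |X i j| := by
  change |∑ j, X i j * t j| ≤ _
  refine (Finset.abs_sum_le_sum_abs _ _).trans (Finset.sum_le_sum fun j _ => ?_)
  rw [abs_mul]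
  exact mul_le_of_le_one_right (abs_nonneg _) ((abs_le_ellNorm hρ t j).trans ht)

/-- An unbounded real supremum has the default value 0, so boundedness is essential. It holds even
for ρ < 1, because the unit ball lies in the cube. -/
lemma bddAbove_ellOpNorm {ρ σ : ℝ≥0∞} (hρ : 0 < ρ) (hσ : 0 < σ)
    (X : Matrix (Fin m) (Fin n) ℝ) : BddAbove (Set.range
      fun t : {t : Fin n → ℝ // ellNorm ρ t ≤ 1} => ellNorm σ (X.mulVec t.1)) := by
  refine ⟨ellNorm σ fun i => ∑ j, |X i j|, ?_⟩
  rintro _ ⟨t, rfl⟩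
  refine ellNorm_mono hσ fun i => ?_
  rw [abs_of_nonneg (Finset.sum_nonneg fun j _ => abs_nonneg (X i j) : (0 : ℝ) ≤ ∑ j, |X i j|)]
  exact abs_mulVec_le hρ X t.2 i

lemma ellNorm_mulVec_le {ρ σ : ℝ≥0∞} (hρ : 0 < ρ) (hσ : 0 < σ)
    (X : Matrix (Fin m) (Fin n) ℝ) {t : Fin n → ℝ} (ht : ellNorm ρ t ≤ 1) :
    ellNorm σ (X.mulVec t) ≤ ellOpNorm ρ σ X :=
  le_ciSup (bddAbove_ellOpNorm hρ hσ X) ⟨t, ht⟩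

lemma ellOpNorm_le {ρ σ : ℝ≥0∞} (hρ : 0 < ρ) {X : Matrix (Fin m) (Fin n) ℝ} {C : ℝ}
    (h : ∀ t, ellNorm ρ t ≤ 1 → ellNorm σ (X.mulVec t) ≤ C) : ellOpNorm ρ σ X ≤ C :=
  have : Fact (0 < ρ) := ⟨hρ⟩
  ciSup_le fun t => h t.1 t.2

lemma ellOpNorm_nonneg {ρ σ : ℝ≥0∞} (hσ : 0 < σ) (X : Matrix (Fin m) (Fin n) ℝ) :
    0 ≤ ellOpNorm ρ σ X :=
  Real.iSup_nonneg fun _ => ellNorm_nonneg hσ _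

lemma ellOpNorm_le_sum {ρ σ : ℝ≥0∞} (hρ : 0 < ρ) (hσ : 1 ≤ σ) (X : Matrix (Fin m) (Fin n) ℝ) :
    ellOpNorm ρ σ X ≤ ∑ i, ∑ j, |X i j| :=
  ellOpNorm_le hρ fun _ ht => (ellNorm_le_sum hσ _).trans
    (Finset.sum_le_sum fun i _ => abs_mulVec_le hρ X ht i)

lemma ellOpNorm_add_le {ρ σ : ℝ≥0∞} (hρ : 0 < ρ) (hσ : 1 ≤ σ) (X Y : Matrix (Fin m) (Fin n) ℝ) :
    ellOpNorm ρ σ (X + Y) ≤ ellOpNorm ρ σ X + ellOpNorm ρ σ Y := by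
  have h0 : 0 < σ := zero_lt_one.trans_le hσ
  refine ellOpNorm_le hρ fun t ht => ?_
  rw [Matrix.add_mulVec]
  exact (ellNorm_add_le hσ _ _).trans
    (add_le_add (ellNorm_mulVec_le hρ h0 X ht) (ellNorm_mulVec_le hρ h0 Y ht))

/-- The norm is Lipschitz in the entries, hence continuous. Measurability follows although the
supremum is over an uncountable set. -/
lemma abs_ellOpNorm_sub_le {ρ σ : ℝ≥0∞} (hρ : 0 < ρ) (hσ : 1 ≤ σ)
    (X Y : Matrix (Fin m) (Fin n) ℝ) :
    |ellOpNorm ρ σ X - ellOpNorm ρ σ Y| ≤ ∑ i, ∑ j, |X i j - Y i j| := by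
  have h1 := ellOpNorm_add_le hρ hσ Y (X - Y)
  have h2 := ellOpNorm_add_le hρ hσ X (Y - X)
  have h3 := ellOpNorm_le_sum hρ hσ (X - Y)
  have h4 := ellOpNorm_le_sum hρ hσ (Y - X)
  simp only [add_sub_cancel, Matrix.sub_apply] at h1 h2 h3 h4
  have : ∑ i, ∑ j, |Y i j - X i j| = ∑ i, ∑ j, |X i j - Y i j| :=
    Finset.sum_congr rfl fun i _ => Finset.sum_congr rfl fun j _ => abs_sub_comm _ _
  rw [abs_le]; constructor <;> linarith

lemma measurable_ellOpNorm {ρ σ : ℝ≥0∞} (hρ : 0 < ρ) (hσ : 1 ≤ σ) :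
    Measurable fun x : Fin m × Fin n → ℝ => ellOpNorm ρ σ (Matrix.of fun i j => x (i, j)) := by
  refine Continuous.measurable ?_
  rw [continuous_iff_continuousAt]
  intro x
  rw [ContinuousAt, tendsto_iff_dist_tendsto_zero]
  have hc : Filter.Tendsto (fun y : Fin m × Fin n → ℝ => ∑ i, ∑ j, |y (i, j) - x (i, j)|)
      (nhds x) (nhds 0) := by
    have : Continuous fun y : Fin m × Fin n → ℝ => ∑ i, ∑ j, |y (i, j) - x (i, j)| := by
      fun_prop
    simpa using this.tendsto x
  refine squeeze_zero (fun _ => dist_nonneg) (fun y => ?_) hc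
  exact abs_ellOpNorm_sub_le hρ hσ _ _

/-- Duality: transposition is an isometry. -/
lemma ellOpNorm_transpose_le (p p' q q' : ℝ≥0∞) [hp : p.HolderConjugate p']
    [hq : q.HolderConjugate q'] (X : Matrix (Fin m) (Fin n) ℝ) :
    ellOpNorm p q X ≤ ellOpNorm q' p' X.transpose := by
  have := hq.symm
  have h1 : 0 < p := ENNReal.HolderConjugate.pos p p'
  have h2 : 0 < q' := ENNReal.HolderConjugate.pos q' q
  have h3 : 0 < p' := by have := hp.symm; exact ENNReal.HolderConjugate.pos p' p
  refine ellOpNorm_le h1 fun t ht => ?_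
  obtain ⟨s, hs, hst⟩ := exists_sum_mul_eq_ellNorm q q' (X.mulVec t)
  rw [← hst]
  have : ∑ i, X.mulVec t i * s i = ∑ j, t j * X.transpose.mulVec s j := by
    change X.mulVec t ⬝ᵥ s = t ⬝ᵥ X.transpose.mulVec s
    rw [dotProduct_comm, Matrix.dotProduct_mulVec, Matrix.mulVec_transpose, dotProduct_comm]
  rw [this]
  refine (le_abs_self _).trans ((abs_sum_mul_le_ellNorm p p' _ _).trans ?_)
  exact (mul_le_of_le_one_left (ellNorm_nonneg h3 _) ht).trans (ellNorm_mulVec_le h2 h3 _ hs)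

lemma ellOpNorm_transpose (p p' q q' : ℝ≥0∞) [hp : p.HolderConjugate p']
    [hq : q.HolderConjugate q'] (X : Matrix (Fin m) (Fin n) ℝ) :
    ellOpNorm q' p' X.transpose = ellOpNorm p q X := by
  refine le_antisymm ?_ (ellOpNorm_transpose_le p p' q q' X)
  have := hq.symm
  have := hp.symm
  simpa using ellOpNorm_transpose_le q' q p' p X.transpose

end EllOpNorm

/-! ### Diagonal operators from ℓ_p to ℓ_2. -/

section DiagNorm

variable {n : ℕ}

/-- The operator norm of the diagonal matrix with entries `b` from `ℓ_p` to `ℓ_2`. -/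
noncomputable def diagNorm (p : ℝ≥0∞) (b : Fin n → ℝ) : ℝ :=
  ⨆ t : {t : Fin n → ℝ // ellNorm p t ≤ 1}, √(∑ j, (b j * t.1 j) ^ 2)

lemma bddAbove_diagNorm {p : ℝ≥0∞} (hp : 0 < p) (b : Fin n → ℝ) : BddAbove (Set.range
      fun t : {t : Fin n → ℝ // ellNorm p t ≤ 1} => √(∑ j, (b j * t.1 j) ^ 2)) := by
  refine ⟨√(∑ j, b j ^ 2), ?_⟩
  rintro _ ⟨t, rfl⟩
  refine Real.sqrt_le_sqrt (Finset.sum_le_sum fun j _ => ?_)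
  rw [mul_pow]
  refine mul_le_of_le_one_right (sq_nonneg _) ?_
  rw [sq_le_one_iff_abs_le_one]
  exact (abs_le_ellNorm hp _ j).trans t.2

lemma le_diagNorm {p : ℝ≥0∞} (hp : 0 < p) (b : Fin n → ℝ) {t : Fin n → ℝ}
    (ht : ellNorm p t ≤ 1) : √(∑ j, (b j * t j) ^ 2) ≤ diagNorm p b :=
  le_ciSup (bddAbove_diagNorm hp b) ⟨t, ht⟩

lemma diagNorm_le {p : ℝ≥0∞} (hp : 0 < p) {b : Fin n → ℝ} {C : ℝ}
    (h : ∀ t, ellNorm p t ≤ 1 → √(∑ j, (b j * t j) ^ 2) ≤ C) : diagNorm p b ≤ C :=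
  have : Fact (0 < p) := ⟨hp⟩
  ciSup_le fun t => h t.1 t.2

lemma diagNorm_nonneg (p : ℝ≥0∞) (b : Fin n → ℝ) : 0 ≤ diagNorm p b :=
  Real.iSup_nonneg fun _ => Real.sqrt_nonneg _

lemma sum_sq_le_diagNorm_sq {p : ℝ≥0∞} (hp : 0 < p) (b : Fin n → ℝ) {t : Fin n → ℝ}
    (ht : ellNorm p t ≤ 1) : ∑ j, (b j * t j) ^ 2 ≤ diagNorm p b ^ 2 :=
  (Real.sqrt_le_left (diagNorm_nonneg p b)).1 (le_diagNorm hp b ht)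

/-- The squared norm of a diagonal matrix is the norm of a linear form on `ℓ_{p/2}`. -/
lemma isLUB_diagNorm_sq {p : ℝ≥0∞} (hp : 0 < p) (b : Fin n → ℝ) :
    IsLUB ((fun s : Fin n → ℝ => |∑ j, b j ^ 2 * s j|) '' {s | ellNorm (p / 2) s ≤ 1})
      (diagNorm p b ^ 2) := by
  have h2 : 0 < p / 2 := ENNReal.div_pos hp.ne' (by simp)
  constructor
  · rintro _ ⟨s, hs, rfl⟩
    have hsq : ∀ j, √|s j| ^ 2 = |s j| := fun j => Real.sq_sqrt (abs_nonneg _)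
    -- The substitution s = t² carries the ball of ℓ_p to the nonnegative part of the ball of
    -- ℓ_{p/2}.
    have ht : ellNorm p (fun j => √|s j|) ≤ 1 := by
      have h3 : ellNorm p (fun j => √|s j|) ^ 2 ≤ 1 := by
        rw [← ellNorm_sq hp]
        refine le_trans (ellNorm_mono h2 fun j => ?_) hs
        simp [hsq]
      exact (sq_le_one_iff₀ (ellNorm_nonneg hp _)).1 h3
    refine le_trans ?_ (sum_sq_le_diagNorm_sq hp b ht)
    refine (Finset.abs_sum_le_sum_abs _ _).trans (Finset.sum_le_sum fun j _ => ?_)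
    rw [mul_pow, hsq, abs_mul, abs_pow, sq_abs]
  · intro C hC
    have hC0 : 0 ≤ C := (abs_nonneg _).trans
      (hC ⟨0, by simp [ellNorm_zero h2], rfl⟩)
    have : diagNorm p b ≤ √C := by
      refine diagNorm_le hp fun t ht => Real.sqrt_le_sqrt ?_
      have hs : ellNorm (p / 2) (fun j => t j ^ 2) ≤ 1 := by
        rw [ellNorm_sq hp]; exact pow_le_one₀ (ellNorm_nonneg hp _) ht
      refine le_trans (le_of_eq ?_) ((le_abs_self _).trans (hC ⟨_, hs, rfl⟩))
      simp [mul_pow]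
    calc diagNorm p b ^ 2 ≤ √C ^ 2 := pow_le_pow_left₀ (diagNorm_nonneg p b) this 2
      _ = C := Real.sq_sqrt hC0

/-- For `p ≥ 2` the norm of a diagonal matrix is an `ℓ`-norm of its entries. -/
lemma diagNorm_eq_of_two_le {p : ℝ≥0∞} (hp : 2 ≤ p) (b : Fin n → ℝ) :
    diagNorm p b = ellNorm (2⁻¹ - p⁻¹)⁻¹ b := by
  have hp0 : 0 < p := lt_of_lt_of_le (by simp) hp
  set r := (2⁻¹ - p⁻¹)⁻¹ with hr
  have hr0 : 0 < r := by
    rw [hr, ENNReal.inv_pos]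
    exact ENNReal.sub_ne_top (by simp)
  -- As 2/p + 2(1/2 - 1/p) = 1, the linear form b² on ℓ_{p/2} has norm ‖b²‖_{r/2} = ‖b‖_r².
  have hconj : (p / 2).HolderConjugate (r / 2) := by
    constructor
    rw [ENNReal.inv_div (by simp) (by simp), ENNReal.inv_div (by simp) (by simp), div_eq_mul_inv,
      div_eq_mul_inv, hr, inv_inv, ENNReal.mul_sub (by simp), ENNReal.mul_inv_cancel (by simp)
      (by simp), inv_one]
    refine add_tsub_cancel_of_le ?_
    rw [← div_eq_mul_inv]
    exact ENNReal.div_le_of_le_mul (by simpa using hp)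
  have hconj' := hconj.symm
  rw [← sq_eq_sq₀ (diagNorm_nonneg p b) (ellNorm_nonneg hr0 b), ← ellNorm_sq hr0]
  have hlub := isLUB_diagNorm_sq hp0 b
  refine le_antisymm (hlub.2 ?_) ?_
  · rintro _ ⟨s, hs, rfl⟩
    refine (abs_sum_mul_le_ellNorm (r / 2) (p / 2) _ _).trans ?_
    exact mul_le_of_le_one_right (ellNorm_nonneg (ENNReal.div_pos hr0.ne' (by simp)) _) hs
  · obtain ⟨y, hy, hxy⟩ := exists_sum_mul_eq_ellNorm (r / 2) (p / 2) fun j => b j ^ 2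
    rw [← hxy]
    exact (le_abs_self _).trans (hlub.1 ⟨y, hy, rfl⟩)

/-- For `p ≤ 2` the norm of a diagonal matrix is at most its largest entry. -/
lemma diagNorm_le_of_le_two {p : ℝ≥0∞} (hp0 : 0 < p) (hp : p ≤ 2) (b : Fin n → ℝ) :
    diagNorm p b ≤ ⨆ j, |b j| := by
  have hM : 0 ≤ ⨆ j, |b j| := Real.iSup_nonneg fun j => abs_nonneg _
  refine diagNorm_le hp0 fun t ht => ?_
  rw [Real.sqrt_le_left hM]
  have hpt : p ≠ ∞ := ne_top_of_le_ne_top (by simp) hp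
  have hp' := ENNReal.toReal_pos hp0.ne' hpt
  have hp2 : p.toReal ≤ 2 := by
    simpa using ENNReal.toReal_mono (by simp) hp
  have hsum : ∑ j, |t j| ^ p.toReal ≤ 1 := by
    rw [ellNorm_eq_sum hp0 hpt] at ht
    by_contra! h
    exact absurd ht (not_le.2 (Real.one_lt_rpow h (by positivity)))
  -- Coordinates are at most 1 in modulus and p ≤ 2, so t² ≤ |t|^p: the ball of ℓ_p lies in that of
  -- ℓ_2.
  have hsq : ∑ j, t j ^ 2 ≤ 1 := by
    refine le_trans (Finset.sum_le_sum fun j _ => ?_) hsum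
    have h1 : |t j| ≤ 1 := (abs_le_ellNorm hp0 t j).trans ht
    rcases eq_or_ne (t j) 0 with h | h
    · simp [h, hp'.ne']
    · rw [← sq_abs, ← Real.rpow_natCast]
      exact Real.rpow_le_rpow_of_exponent_ge (abs_pos.2 h) h1 (by simpa using hp2)
  calc ∑ j, (b j * t j) ^ 2 ≤ ∑ j, (⨆ j, |b j|) ^ 2 * t j ^ 2 := by
        refine Finset.sum_le_sum fun j _ => ?_
        rw [mul_pow]
        refine mul_le_mul_of_nonneg_right ?_ (sq_nonneg _)
        rw [← sq_abs]
        exact pow_le_pow_left₀ (abs_nonneg _) (le_iSup_fintype (fun j => |b j|) j) 2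
    _ ≤ _ := by rw [← Finset.mul_sum]; exact mul_le_of_le_one_right (sq_nonneg _) hsq

end DiagNorm

/-! ### The quantities D₁ and D₂ of a tensor. -/

section TensorFormulas

variable {m n : ℕ}

/-- The matrix of squares has rank one: it sends t to the vector a² times the linear form b² at t,
so its norm factors. -/
lemma D1_eq_of_tensor {p q : ℝ≥0∞} (hp : 0 < p) (hq : 0 < q) {A : Matrix (Fin m) (Fin n) ℝ}
    {a : Fin m → ℝ} {b : Fin n → ℝ} (hA : ∀ i j, A i j = a i * b j) :
    D1 p q A = ellNorm q a * diagNorm p b := by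
  have hp2 : 0 < p / 2 := ENNReal.div_pos hp.ne' (by simp)
  have hq2 : 0 < q / 2 := ENNReal.div_pos hq.ne' (by simp)
  have hmv : ∀ t, (A.map (· ^ 2)).mulVec t = fun i => a i ^ 2 * ∑ j, b j ^ 2 * t j := by
    intro t; ext i
    simp only [Matrix.mulVec, dotProduct, Matrix.map_apply, hA, Finset.mul_sum]
    exact Finset.sum_congr rfl fun j _ => by ring
  have hn : ∀ t, ellNorm (q / 2) ((A.map (· ^ 2)).mulVec t)
      = ellNorm q a ^ 2 * |∑ j, b j ^ 2 * t j| := by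
    intro t; rw [hmv, ellNorm_mul_const hq2, ellNorm_sq hq]
  have key : ellOpNorm (p / 2) (q / 2) (A.map (· ^ 2)) = (ellNorm q a * diagNorm p b) ^ 2 := by
    have : Fact (0 < p / 2) := ⟨hp2⟩
    simp only [ellOpNorm, hn]
    rw [← Real.mul_iSup_of_nonneg (sq_nonneg _), mul_pow]
    congr 1
    have := (isLUB_diagNorm_sq hp b).csSup_eq ⟨_, 0, by simp [ellNorm_zero hp2], rfl⟩
    rw [← this, sSup_image']
    rfl
  rw [D1, key, Real.sqrt_sq (mul_nonneg (ellNorm_nonneg hq a) (diagNorm_nonneg p b))]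

/-- This symmetry transfers every statement about D₁ to D₂. -/
lemma D1_transpose (p q : ℝ≥0∞) (A : Matrix (Fin m) (Fin n) ℝ) :
    D1 q.conjExponent p.conjExponent A.transpose = D2 p q A :=
  rfl

end TensorFormulas

/-! ### Moments and tails of one Gaussian variable. -/

section OneDim

lemma gaussianPDFReal_std (x : ℝ) :
    gaussianPDFReal 0 1 x = (√(2 * Real.pi))⁻¹ * Real.exp (-x ^ 2 / 2) := by
  rw [gaussianPDFReal_def]; simp

lemma gaussianPDFReal_mul_exp_sq (x : ℝ) :
    gaussianPDFReal 0 1 x * Real.exp (x ^ 2 / 4)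
      = (√(2 * Real.pi))⁻¹ * Real.exp (-(1 / 4) * x ^ 2) := by
  rw [gaussianPDFReal_std, mul_assoc, ← Real.exp_add]
  congr 2; ring

/-- The coefficient 1/4 is below the critical 1/2. This one exponential moment controls both the
power moments and the weighted maxima. -/
lemma integrable_exp_sq_gaussianReal :
    Integrable (fun x : ℝ => Real.exp (x ^ 2 / 4)) (gaussianReal 0 1) := by
  rw [integrable_gaussianReal_iff_pdf]
  simp only [gaussianPDFReal_mul_exp_sq]
  exact (integrable_exp_neg_mul_sq (by norm_num)).const_mul _

lemma integral_exp_sq_gaussianReal :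
    ∫ x, Real.exp (x ^ 2 / 4) ∂(gaussianReal 0 1) = √2 := by
  rw [integral_gaussianReal_eq_integral_smul one_ne_zero]
  simp only [smul_eq_mul, gaussianPDFReal_mul_exp_sq]
  rw [integral_const_mul, integral_gaussian, ← Real.sqrt_inv, ← Real.sqrt_mul (by positivity)]
  congr 1
  have := Real.pi_ne_zero
  field_simp
  norm_num

/-- The inequality y ≤ e^y at y = x²/(2r), raised to the power r/2. -/
lemma abs_rpow_le_exp_sq {r : ℝ} (hr : 0 < r) (x : ℝ) :
    |x| ^ r ≤ (2 * r) ^ (r / 2) * Real.exp (x ^ 2 / 4) := by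
  have h1 : |x| ^ r = (x ^ 2) ^ (r / 2) := by
    rw [← sq_abs, ← Real.rpow_natCast, ← Real.rpow_mul (abs_nonneg _)]
    congr 1; push_cast; ring
  have h2 : x ^ 2 ≤ 2 * r * Real.exp (x ^ 2 / (2 * r)) := by
    have := Real.add_one_le_exp (x ^ 2 / (2 * r))
    have h3 : x ^ 2 / (2 * r) ≤ Real.exp (x ^ 2 / (2 * r)) := by linarith
    rwa [div_le_iff₀ (by positivity), mul_comm] at h3
  rw [h1]
  calc (x ^ 2) ^ (r / 2) ≤ (2 * r * Real.exp (x ^ 2 / (2 * r))) ^ (r / 2) := by gcongr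
    _ = _ := by
      rw [Real.mul_rpow (by positivity) (by positivity), ← Real.exp_mul]
      congr 2; field_simp; norm_num

lemma integrable_abs_rpow_gaussianReal {r : ℝ} (hr : 0 < r) :
    Integrable (fun x : ℝ => |x| ^ r) (gaussianReal 0 1) := by
  refine Integrable.mono' (integrable_exp_sq_gaussianReal.const_mul ((2 * r) ^ (r / 2)))
    (by fun_prop : Measurable fun x : ℝ => |x| ^ r).aestronglyMeasurable
    (.of_forall fun x => ?_)
  rw [Real.norm_of_nonneg (by positivity)]
  exact abs_rpow_le_exp_sq hr x

/-- Absolute moments of the standard Gaussian. -/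
lemma integral_abs_rpow_gaussianReal_le {r : ℝ} (hr : 1 ≤ r) :
    ∫ x, |x| ^ r ∂(gaussianReal 0 1) ≤ (2 * √r) ^ r := by
  have hr0 : 0 < r := by linarith
  calc ∫ x, |x| ^ r ∂(gaussianReal 0 1)
      ≤ ∫ x, (2 * r) ^ (r / 2) * Real.exp (x ^ 2 / 4) ∂(gaussianReal 0 1) :=
        integral_mono (integrable_abs_rpow_gaussianReal hr0)
          (integrable_exp_sq_gaussianReal.const_mul _) fun x => abs_rpow_le_exp_sq hr0 x
    _ = (2 * r) ^ (r / 2) * √2 := by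
        rw [integral_const_mul, integral_exp_sq_gaussianReal]
    _ ≤ (2 * r) ^ (r / 2) * 2 ^ (r / 2) := by
        gcongr
        rw [Real.sqrt_eq_rpow]
        exact Real.rpow_le_rpow_of_exponent_le (by norm_num) (by linarith)
    _ = (2 * √r) ^ r := by
        rw [← Real.mul_rpow (by positivity) (by positivity)]
        have : 2 * r * 2 = (2 * √r) ^ (2 : ℝ) := by
          rw [Real.rpow_two, mul_pow, Real.sq_sqrt hr0.le]; ring
        rw [this, ← Real.rpow_mul (by positivity)]
        congr 1; ring

/-- A lower bound for the Gaussian tail. -/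
lemma le_gaussianReal_tail {u : ℝ} (hu : 0 ≤ u) :
    1 / 9 * Real.exp (-u ^ 2) ≤ (gaussianReal 0 1).real (Set.Ici u) := by
  have h1 : (gaussianReal 0 1).real (Set.Icc u (u + 1)) ≤ (gaussianReal 0 1).real (Set.Ici u) :=
    measureReal_mono fun x hx => hx.1
  refine le_trans ?_ h1
  rw [Measure.real, gaussianReal_apply_eq_integral 0 one_ne_zero, ENNReal.toReal_ofReal
    (setIntegral_nonneg measurableSet_Icc fun x _ => gaussianPDFReal_nonneg 0 1 x)]
  -- For x ≤ u + 1 one has x²/2 ≤ u² + 1. The factor 1/9 is a lower bound 1/3 for 1/√(2π) times one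
  -- for e⁻¹.
  have h2 : ∀ x ∈ Set.Icc u (u + 1), 1 / 9 * Real.exp (-u ^ 2) ≤ gaussianPDFReal 0 1 x := by
    intro x hx
    rw [gaussianPDFReal_std]
    have e1 : (1 : ℝ) / 3 ≤ (√(2 * Real.pi))⁻¹ := by
      rw [one_div]
      refine inv_anti₀ (by positivity) ?_
      rw [Real.sqrt_le_left (by norm_num)]
      nlinarith [Real.pi_lt_d2]
    have e2 : (1 : ℝ) / 3 ≤ Real.exp (-1) := by
      rw [Real.exp_neg, one_div]
      exact inv_anti₀ (by positivity) (by linarith [Real.exp_one_lt_d9])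
    have e3 : Real.exp (-1) * Real.exp (-u ^ 2) ≤ Real.exp (-x ^ 2 / 2) := by
      rw [← Real.exp_add]
      refine Real.exp_le_exp.2 ?_
      nlinarith [hx.1, hx.2, sq_nonneg (u - 1), mul_self_le_mul_self (hu.trans hx.1) hx.2]
    calc 1 / 9 * Real.exp (-u ^ 2) = 1 / 3 * (1 / 3 * Real.exp (-u ^ 2)) := by ring
      _ ≤ (√(2 * Real.pi))⁻¹ * (Real.exp (-1) * Real.exp (-u ^ 2)) := by gcongr
      _ ≤ _ := by gcongr
  have h3 := setIntegral_mono_on (μ := volume) (s := Set.Icc u (u + 1))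
    (f := fun _ => 1 / 9 * Real.exp (-u ^ 2)) continuous_const.integrableOn_Icc
    (integrable_gaussianPDFReal 0 1).integrableOn measurableSet_Icc h2
  simpa using h3

lemma integrable_abs_gaussianReal : Integrable (fun x : ℝ => |x|) (gaussianReal 0 1) :=
  integrable_id_gaussianReal_std.abs

/-- Markov's inequality at level 1: the tail there is at least e⁻¹/9 ≥ 1/27. -/
lemma le_integral_abs_gaussianReal : 1 / 27 ≤ ∫ x, |x| ∂(gaussianReal 0 1) := by
  have h1 := le_gaussianReal_tail zero_le_one
  have e2 : (1 : ℝ) / 3 ≤ Real.exp (-1) := by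
    rw [Real.exp_neg, one_div]
    exact inv_anti₀ (by positivity) (by linarith [Real.exp_one_lt_d9])
  have h2 : (gaussianReal 0 1).real (Set.Ici 1) ≤ ∫ x, |x| ∂(gaussianReal 0 1) := by
    rw [← integral_indicator_one measurableSet_Ici]
    refine integral_mono ((integrable_const (1 : ℝ)).indicator measurableSet_Ici)
      integrable_abs_gaussianReal fun x => ?_
    by_cases hx : x ∈ Set.Ici (1 : ℝ)
    · rw [Set.indicator_of_mem hx]; exact le_trans hx (le_abs_self x)
    · rw [Set.indicator_of_notMem hx]; exact abs_nonneg x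
  norm_num at h1
  linarith

end OneDim

set_option linter.unusedSectionVars false

/-! ### Expected ℓ_q norms of weighted Gaussian vectors. -/

section RandomVectors

variable {k : ℕ} {Ω : Type*} [MeasurableSpace Ω] {μ : Measure Ω}

lemma measurable_ellNorm {p : ℝ≥0∞} (hp : 0 < p) :
    Measurable fun x : Fin k → ℝ => ellNorm p x := by
  by_cases h : p = ∞
  · subst h
    simp only [ellNorm_top]
    exact Measurable.iSup fun i => by fun_prop
  · simp only [ellNorm_eq_sum hp h]
    fun_prop

lemma integrable_ellNorm {p : ℝ≥0∞} (hp : 1 ≤ p) {X : Fin k → Ω → ℝ}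
    (hX : ∀ i, Integrable (X i) μ) : Integrable (fun ω => ellNorm p fun i => X i ω) μ := by
  have h0 : 0 < p := zero_lt_one.trans_le hp
  refine Integrable.mono' (integrable_finsetSum Finset.univ fun i _ => (hX i).abs)
    ((measurable_ellNorm h0).comp_aemeasurable
      (aemeasurable_pi_lambda _ fun i => (hX i).aemeasurable)).aestronglyMeasurable
    (.of_forall fun ω => ?_)
  rw [Real.norm_of_nonneg (ellNorm_nonneg h0 _)]
  exact ellNorm_le_sum hp _

lemma integrable_of_hasLaw_gaussian {h : Ω → ℝ} (hh : HasLaw h (gaussianReal 0 1) μ) {f : ℝ → ℝ}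
    (hf : Integrable f (gaussianReal 0 1)) : Integrable (fun ω => f (h ω)) μ := by
  rw [← hh.map_eq] at hf
  exact hf.comp_aemeasurable hh.aemeasurable

lemma integral_of_hasLaw_gaussian {h : Ω → ℝ} (hh : HasLaw h (gaussianReal 0 1) μ) {f : ℝ → ℝ}
    (hf : Integrable f (gaussianReal 0 1)) :
    ∫ ω, f (h ω) ∂μ = ∫ x, f x ∂(gaussianReal 0 1) :=
  hh.integral_comp hf.aestronglyMeasurable

variable [IsProbabilityMeasure μ] {a : Fin k → ℝ} {h : Fin k → Ω → ℝ}

lemma integrable_ellNorm_gaussian {q : ℝ≥0∞} (hq : 1 ≤ q)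
    (hh : ∀ i, HasLaw (h i) (gaussianReal 0 1) μ) :
    Integrable (fun ω => ellNorm q fun i => a i * h i ω) μ :=
  integrable_ellNorm hq fun i =>
    (integrable_of_hasLaw_gaussian (hh i) integrable_id_gaussianReal_std).const_mul (a i)

/-- `𝔼 ‖(a_i h_i)‖_q ≤ 2 √q ‖a‖_q` for finite `q`. -/
lemma integral_ellNorm_gaussian_le {q : ℝ≥0∞} (hq : 1 ≤ q) (hq' : q ≠ ∞)
    (hh : ∀ i, HasLaw (h i) (gaussianReal 0 1) μ) :
    ∫ ω, ellNorm q (fun i => a i * h i ω) ∂μ ≤ 2 * √q.toReal * ellNorm q a := by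
  have h0 : 0 < q := zero_lt_one.trans_le hq
  set r := q.toReal with hr_def
  have hr : 1 ≤ r := by simpa using ENNReal.toReal_mono hq' hq
  have hr0 : 0 < r := by linarith
  rcases (ellNorm_nonneg h0 a).eq_or_lt with ha | ha
  · have : ∀ i, a i = 0 := fun i => by
      have := abs_le_ellNorm h0 a i
      rw [← ha] at this
      exact abs_nonpos_iff.1 this
    simp only [this, zero_mul, ← ha, mul_zero]
    have hz := ellNorm_zero (k := k) h0
    rw [Pi.zero_def] at hz
    simp [hz]
  set M := 2 * √r * ellNorm q a with hM_def
  have hM : 0 < M := by positivity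
  have hpow : ellNorm q a ^ r = ∑ i, |a i| ^ r := by
    rw [ellNorm_eq_sum h0 hq', ← Real.rpow_mul (by positivity), one_div_mul_cancel hr0.ne',
      Real.rpow_one]
  set S : Ω → ℝ := fun ω => ∑ i, |a i| ^ r * |h i ω| ^ r with hS_def
  have hint : ∀ i, Integrable (fun ω => |h i ω| ^ r) μ := fun i =>
    integrable_of_hasLaw_gaussian (hh i) (integrable_abs_rpow_gaussianReal hr0)
  have hSi : Integrable S μ := integrable_finsetSum _ fun i _ => (hint i).const_mul _
  have hES : ∫ ω, S ω ∂μ ≤ M ^ r := by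
    calc ∫ ω, S ω ∂μ = ∑ i, |a i| ^ r * ∫ x, |x| ^ r ∂(gaussianReal 0 1) := by
          rw [hS_def, integral_finsetSum _ fun i _ => (hint i).const_mul _]
          refine Finset.sum_congr rfl fun i _ => ?_
          rw [integral_const_mul,
            integral_of_hasLaw_gaussian (hh i) (integrable_abs_rpow_gaussianReal hr0)]
      _ ≤ ∑ i, |a i| ^ r * (2 * √r) ^ r := by
          gcongr with i
          exact integral_abs_rpow_gaussianReal_le hr
      _ = M ^ r := by
          rw [← Finset.sum_mul, ← hpow, hM_def, Real.mul_rpow (by positivity) ha.le, mul_comm]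
  -- The concave function S^(1/r) lies below its tangent at M^r (Bernoulli's inequality).
  -- Integrating this linear bound plays the role of Jensen's inequality.
  have hpt : ∀ ω, ellNorm q (fun i => a i * h i ω) ≤ M * (1 + 1 / r * (S ω / M ^ r - 1)) := by
    intro ω
    have hS0 : 0 ≤ S ω := by positivity
    have e : ellNorm q (fun i => a i * h i ω) = (S ω) ^ (1 / r) := by
      rw [ellNorm_eq_sum h0 hq']
      congr 1
      exact Finset.sum_congr rfl fun i _ => by
        rw [abs_mul, Real.mul_rpow (abs_nonneg _) (abs_nonneg _)]
    have hb := rpow_one_add_le_one_add_mul_self (s := S ω / M ^ r - 1)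
      (by have : 0 ≤ S ω / M ^ r := by positivity
          linarith) (p := 1 / r) (by positivity) (by rw [div_le_one hr0]; exact hr)
    rw [add_sub_cancel, Real.div_rpow hS0 (by positivity), ← Real.rpow_mul hM.le,
      mul_one_div_cancel hr0.ne', Real.rpow_one, div_le_iff₀ hM, mul_comm] at hb
    rw [e]; exact hb
  have hlin : ∀ ω, M * (1 + 1 / r * (S ω / M ^ r - 1))
      = M * (1 - 1 / r) + M / r / M ^ r * S ω := fun ω => by ring
  simp only [hlin] at hpt
  calc ∫ ω, ellNorm q (fun i => a i * h i ω) ∂μ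
      ≤ ∫ ω, M * (1 - 1 / r) + M / r / M ^ r * S ω ∂μ :=
        integral_mono (integrable_ellNorm_gaussian hq hh)
          ((integrable_const _).add (hSi.const_mul _)) hpt
    _ = M * (1 - 1 / r) + M / r / M ^ r * ∫ ω, S ω ∂μ := by
        rw [integral_add (integrable_const _) (hSi.const_mul _),
          integral_const_mul (M / r / M ^ r) S]
        simp
    _ ≤ M * (1 - 1 / r) + M / r / M ^ r * M ^ r := by gcongr
    _ = M := by
        have : M ^ r ≠ 0 := by positivity
        field_simp; ring

/-- `𝔼 ‖(a_i h_i)‖_q ≥ c ‖a‖_q`. -/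
lemma le_integral_ellNorm_gaussian {q : ℝ≥0∞} (hq : 1 ≤ q)
    (hh : ∀ i, HasLaw (h i) (gaussianReal 0 1) μ) :
    1 / 27 * ellNorm q a ≤ ∫ ω, ellNorm q (fun i => a i * h i ω) ∂μ := by
  have h0 : 0 < q := zero_lt_one.trans_le hq
  have := ENNReal.HolderConjugate.conjExponent hq
  -- Testing the random norm against the vector dual to |a| gives E|g| ‖a‖_q; independence plays no
  -- role.
  obtain ⟨y, hy, hay⟩ := exists_sum_mul_eq_ellNorm q q.conjExponent fun i => |a i|
  have hEq : ellNorm q (fun i => |a i|) = ellNorm q a := ellNorm_congr_abs h0 (by simp)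
  have hi : ∀ i, Integrable (fun ω => |a i| * y i * |h i ω|) μ := fun i =>
    (integrable_of_hasLaw_gaussian (hh i) integrable_abs_gaussianReal).const_mul _
  calc 1 / 27 * ellNorm q a ≤ (∫ x, |x| ∂(gaussianReal 0 1)) * ellNorm q a :=
        mul_le_mul_of_nonneg_right le_integral_abs_gaussianReal (ellNorm_nonneg h0 a)
    _ = ∫ ω, ∑ i, |a i| * y i * |h i ω| ∂μ := by
        rw [integral_finsetSum _ fun i _ => hi i, ← hEq, ← hay, Finset.mul_sum]
        refine Finset.sum_congr rfl fun i _ => ?_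
        rw [integral_const_mul, integral_of_hasLaw_gaussian (hh i) integrable_abs_gaussianReal,
          mul_comm]
    _ ≤ ∫ ω, ellNorm q (fun i => a i * h i ω) ∂μ := by
        refine integral_mono (integrable_finsetSum _ fun i _ => hi i)
          (integrable_ellNorm_gaussian hq hh) fun ω => ?_
        have hH := abs_sum_mul_le_ellNorm q q.conjExponent (fun i => |a i * h i ω|) y
        have hE2 : ellNorm q (fun i => |a i * h i ω|) = ellNorm q (fun i => a i * h i ω) :=
          ellNorm_congr_abs h0 (by simp)
        rw [hE2] at hH
        have e : ∑ i, |a i| * y i * |h i ω| = ∑ i, |a i * h i ω| * y i :=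
          Finset.sum_congr rfl fun i _ => by rw [abs_mul]; ring
        simp only [e]
        exact (le_abs_self _).trans (hH.trans
          (mul_le_of_le_one_right (ellNorm_nonneg h0 _) hy))

end RandomVectors

/-! ### Maxima of weighted Gaussians and the nonincreasing rearrangement. -/

section Rearrangement

variable {k : ℕ}

/-- `max_i √(ln (i + 1)) a_i^*`, with indices `i ≥ 1`. -/
noncomputable def rearrMax (a : Fin k → ℝ) : ℝ :=
  ⨆ i : Fin k, √(Real.log ((i : ℝ) + 2)) * decrRearr a i

lemma decrRearr_nonneg (a : Fin k → ℝ) (i : Fin k) : 0 ≤ decrRearr a i := abs_nonneg _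

lemma rearrMax_nonneg (a : Fin k → ℝ) : 0 ≤ rearrMax a :=
  Real.iSup_nonneg fun i => mul_nonneg (Real.sqrt_nonneg _) (decrRearr_nonneg a i)

lemma le_rearrMax (a : Fin k → ℝ) (i : Fin k) :
    √(Real.log ((i : ℝ) + 2)) * decrRearr a i ≤ rearrMax a :=
  le_iSup_fintype (fun i : Fin k => √(Real.log ((i : ℝ) + 2)) * decrRearr a i) i

lemma decrRearr_le_of_le (a : Fin k → ℝ) {i j : Fin k} (hij : i ≤ j) :
    decrRearr a j ≤ decrRearr a i := by
  have := Tuple.monotone_sort (fun l => -|a l|) hij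
  simpa [decrRearr] using this

/-- Ties, or c = 0, may change the sorting permutation, but two monotone rearrangements of the same
values coincide. -/
lemma decrRearr_const_mul (c : ℝ) (a : Fin k → ℝ) (i : Fin k) :
    decrRearr (fun j => c * a j) i = |c| * decrRearr a i := by
  have h1 : Monotone ((fun l => -|c * a l|) ∘ Tuple.sort fun l => -|c * a l|) :=
    Tuple.monotone_sort _
  have h2 : Monotone ((fun l => -|c * a l|) ∘ Tuple.sort fun l => -|a l|) := by
    intro x y hxy
    have := mul_le_mul_of_nonneg_left (Tuple.monotone_sort (fun l => -|a l|) hxy) (abs_nonneg c)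
    simp only [Function.comp_apply, mul_neg, ← abs_mul] at this ⊢
    exact this
  have h3 := congrFun (Tuple.unique_monotone h1 h2) i
  simp only [Function.comp_apply, neg_inj] at h3
  rw [decrRearr, h3, decrRearr, abs_mul]

lemma rearrMax_const_mul (c : ℝ) (a : Fin k → ℝ) :
    rearrMax (fun j => c * a j) = |c| * rearrMax a := by
  simp only [rearrMax, decrRearr_const_mul]
  rw [Real.mul_iSup_of_nonneg (abs_nonneg c)]
  congr 1; ext i; ring

lemma half_lt_log_add_two (x : ℕ) : 1 / 2 < Real.log ((x : ℝ) + 2) := by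
  have : Real.log 2 ≤ Real.log ((x : ℝ) + 2) :=
    Real.log_le_log (by norm_num) (by linarith [Nat.cast_nonneg (α := ℝ) x])
  linarith [Real.log_two_gt_d9]

lemma sum_inv_sq_le_one (k : ℕ) : ∑ i : Fin k, (((i : ℝ) + 2) ^ 2)⁻¹ ≤ 1 := by
  have h : ∀ n : ℕ, ∑ i ∈ Finset.range n, (((i : ℝ) + 2) ^ 2)⁻¹ ≤ 1 - 1 / ((n : ℝ) + 1) := by
    intro n
    induction n with
    | zero => simp
    | succ n ih =>
      rw [Finset.sum_range_succ]
      have : (((n : ℝ) + 2) ^ 2)⁻¹ ≤ 1 / ((n : ℝ) + 1) - 1 / ((n : ℝ) + 2) := by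
        rw [div_sub_div _ _ (by positivity) (by positivity), inv_eq_one_div,
          div_le_div_iff₀ (by positivity) (by positivity)]
        nlinarith [Nat.cast_nonneg (α := ℝ) n]
      push_cast
      rw [show (n : ℝ) + 1 + 1 = n + 2 by ring]
      linarith
  rw [Fin.sum_univ_eq_sum_range (fun i => (((i : ℝ) + 2) ^ 2)⁻¹)]
  have := h k
  have : 0 ≤ 1 / ((k : ℝ) + 1) := by positivity
  linarith

/-- With L = log(i+2), apply y + 1 ≤ e^y at y = (x² - 8L)/4. The multiple 8 makes e^(-2L) = (i+2)⁻²,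
which is summable, so the supremum over i may be replaced by a sum of bounded expectation. -/
lemma abs_div_sqrt_log_le (x : ℝ) (i : ℕ) :
    |x| / √(Real.log ((i : ℝ) + 2))
      ≤ 9 + 8 * (Real.exp (x ^ 2 / 4) * (((i : ℝ) + 2) ^ 2)⁻¹) := by
  set L := Real.log ((i : ℝ) + 2) with hL_def
  have hL : 1 / 2 < L := half_lt_log_add_two i
  have hL0 : 0 < L := by linarith
  have hexp : Real.exp ((x ^ 2 - 8 * L) / 4) = Real.exp (x ^ 2 / 4) * (((i : ℝ) + 2) ^ 2)⁻¹ := by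
    have : (x ^ 2 - 8 * L) / 4 = x ^ 2 / 4 - (L + L) := by ring
    rw [this, Real.exp_sub, Real.exp_add, hL_def, Real.exp_log (by positivity)]
    field_simp
  have h1 : x ^ 2 ≤ 8 * L + 4 * Real.exp ((x ^ 2 - 8 * L) / 4) := by
    have := Real.add_one_le_exp ((x ^ 2 - 8 * L) / 4)
    linarith
  have h2 : x ^ 2 / L ≤ 8 + 8 * Real.exp ((x ^ 2 - 8 * L) / 4) := by
    rw [div_le_iff₀ hL0]
    nlinarith [Real.exp_pos ((x ^ 2 - 8 * L) / 4)]
  have h3 : |x| / √L ≤ 1 + x ^ 2 / L := by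
    have : x ^ 2 / L = (|x| / √L) ^ 2 := by rw [div_pow, sq_abs, Real.sq_sqrt hL0.le]
    rw [this]
    nlinarith [sq_nonneg (|x| / √L - 1 / 2)]
  rw [← hexp]; linarith

variable {Ω : Type*} [MeasurableSpace Ω] {μ : Measure Ω} [IsProbabilityMeasure μ]
  {h : Fin k → Ω → ℝ}

/-- Upper bound for the expected maximum of weighted Gaussians (without independence). -/
lemma integral_ellNorm_top_gaussian_le (a : Fin k → ℝ)
    (hh : ∀ i, HasLaw (h i) (gaussianReal 0 1) μ) :
    ∫ ω, ellNorm ∞ (fun i => a i * h i ω) ∂μ ≤ 25 * rearrMax a := by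
  set σ := Tuple.sort fun l => -|a l| with hσ
  set R := rearrMax a with hR_def
  have hR : 0 ≤ R := rearrMax_nonneg a
  have hie : ∀ i, Integrable (fun ω => Real.exp (h i ω ^ 2 / 4)) μ := fun i =>
    integrable_of_hasLaw_gaussian (hh i) integrable_exp_sq_gaussianReal
  set W : Ω → ℝ := fun ω => ∑ i : Fin k, Real.exp (h (σ i) ω ^ 2 / 4) * (((i : ℝ) + 2) ^ 2)⁻¹
  have hWi : Integrable W μ := integrable_finsetSum _ fun i _ => (hie _).mul_const _
  have hW : ∫ ω, W ω ∂μ ≤ 2 := by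
    rw [integral_finsetSum _ fun i _ => (hie _).mul_const _]
    calc ∑ i : Fin k, ∫ ω, Real.exp (h (σ i) ω ^ 2 / 4) * (((i : ℝ) + 2) ^ 2)⁻¹ ∂μ
        = √2 * ∑ i : Fin k, (((i : ℝ) + 2) ^ 2)⁻¹ := by
          rw [Finset.mul_sum]
          refine Finset.sum_congr rfl fun i _ => ?_
          rw [integral_mul_const, integral_of_hasLaw_gaussian (hh _)
            integrable_exp_sq_gaussianReal, integral_exp_sq_gaussianReal]
      _ ≤ √2 * 1 := by gcongr; exact sum_inv_sq_le_one k
      _ ≤ 2 := by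
          rw [mul_one, Real.sqrt_le_left (by norm_num)]; norm_num
  have hpt : ∀ ω, ellNorm ∞ (fun i => a i * h i ω) ≤ R * (9 + 8 * W ω) := by
    intro ω
    rw [ellNorm_top]
    have hW0 : 0 ≤ W ω := by positivity
    refine Real.iSup_le (fun i => ?_) (by positivity)
    obtain ⟨l, rfl⟩ := σ.surjective i
    set s := √(Real.log ((l : ℝ) + 2))
    have hs : 0 < s := Real.sqrt_pos.2 (by linarith [half_lt_log_add_two l])
    -- At sorted position l the coefficient is at most R/√log(l+2), and the logarithm is absorbed by
    -- the Gaussian.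
    have h1 : |a (σ l)| ≤ R / s := by
      rw [le_div_iff₀ hs, mul_comm]; exact le_rearrMax a l
    rw [abs_mul]
    calc |a (σ l)| * |h (σ l) ω| ≤ R / s * |h (σ l) ω| := by gcongr
      _ = R * (|h (σ l) ω| / s) := by ring
      _ ≤ R * (9 + 8 * (Real.exp (h (σ l) ω ^ 2 / 4) * (((l : ℝ) + 2) ^ 2)⁻¹)) := by
          gcongr; exact abs_div_sqrt_log_le _ l
      _ ≤ R * (9 + 8 * W ω) := by
          gcongr
          exact Finset.single_le_sum
            (f := fun i : Fin k => Real.exp (h (σ i) ω ^ 2 / 4) * (((i : ℝ) + 2) ^ 2)⁻¹)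
            (fun i _ => by positivity) (Finset.mem_univ l)
  have hi : Integrable (fun ω => R * (9 + 8 * W ω)) μ :=
    ((integrable_const _).add (hWi.const_mul 8)).const_mul R
  calc ∫ ω, ellNorm ∞ (fun i => a i * h i ω) ∂μ ≤ ∫ ω, R * (9 + 8 * W ω) ∂μ :=
        integral_mono (integrable_ellNorm_gaussian (by simp) hh) hi hpt
    _ = R * (9 + 8 * ∫ ω, W ω ∂μ) := by
        rw [integral_const_mul, integral_add (integrable_const _) (hWi.const_mul 8),
          integral_const_mul]
        simp
    _ ≤ R * (9 + 8 * 2) := by gcongr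
    _ = 25 * R := by ring

/-- Lower bound for the expected maximum of independent weighted Gaussians. -/
lemma le_integral_ellNorm_top_gaussian (a : Fin k → ℝ)
    (hh : ∀ i, HasLaw (h i) (gaussianReal 0 1) μ) (hind : iIndepFun h μ) :
    1 / 19 * rearrMax a ≤ ∫ ω, ellNorm ∞ (fun i => a i * h i ω) ∂μ := by
  have hnn : 0 ≤ ∫ ω, ellNorm ∞ (fun i => a i * h i ω) ∂μ :=
    integral_nonneg fun ω => ellNorm_nonneg (by simp) _
  rw [one_div, inv_mul_le_iff₀ (by norm_num)]
  refine Real.iSup_le (fun l => ?_) (by positivity)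
  set σ := Tuple.sort fun l => -|a l| with hσ
  set u := √(Real.log ((l : ℝ) + 2)) with hu_def
  have hlog : 0 < Real.log ((l : ℝ) + 2) := by linarith [half_lt_log_add_two l]
  have hu0 : 0 ≤ u := Real.sqrt_nonneg _
  set n : ℝ := (l : ℝ) + 1 with hn
  have hn1 : 1 ≤ n := by
    have := Nat.cast_nonneg (α := ℝ) (l : ℕ)
    linarith
  -- By the choice of u, e^(-u²) = 1/(l+2) ≥ 1/(2n) with n = l + 1; this halves the 1/9 of the tail
  -- bound.
  have htail : 1 / 18 / n ≤ (gaussianReal 0 1).real (Set.Ici u) := by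
    refine le_trans ?_ (le_gaussianReal_tail hu0)
    rw [hu_def, Real.sq_sqrt hlog.le, Real.exp_neg, Real.exp_log (by positivity), ← one_div,
      div_div, div_mul_div_comm, div_le_div_iff₀ (by positivity) (by positivity)]
    linarith
  -- These are the l + 1 largest coefficients. By independence all their Gaussians stay below u with
  -- probability at most (1 - 1/(18n))^n ≤ e^(-1/18) ≤ 18/19.
  set S : Finset (Fin k) := (Finset.Iic l).map σ.toEmbedding with hS
  have hcard : (S.card : ℝ) = n := by
    rw [hS, Finset.card_map, Fin.card_Iic]; push_cast; rfl
  set B : Set Ω := ⋂ i ∈ S, h i ⁻¹' Set.Iio u with hB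
  have hBm : NullMeasurableSet B μ := by
    refine NullMeasurableSet.biInter S.countable_toSet fun i _ => ?_
    exact (hh i).aemeasurable.nullMeasurable measurableSet_Iio
  have hPB : μ.real B ≤ 18 / 19 := by
    have h1 : μ B = ∏ i ∈ S, μ (h i ⁻¹' Set.Iio u) :=
      hind.measure_inter_preimage_eq_mul S fun i _ => measurableSet_Iio
    have h2 : ∀ i, μ.real (h i ⁻¹' Set.Iio u) = 1 - (gaussianReal 0 1).real (Set.Ici u) := by
      intro i
      rw [← probReal_compl_eq_one_sub measurableSet_Ici, Set.compl_Ici, Measure.real, Measure.real,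
        ← (hh i).map_eq, Measure.map_apply_of_aemeasurable (hh i).aemeasurable measurableSet_Iio]
    have h3 : μ.real B = ∏ i ∈ S, μ.real (h i ⁻¹' Set.Iio u) := by
      rw [Measure.real, h1, ENNReal.toReal_prod]; rfl
    rw [h3, Finset.prod_congr rfl fun i _ => h2 i, Finset.prod_const]
    calc (1 - (gaussianReal 0 1).real (Set.Ici u)) ^ S.card
        ≤ Real.exp (-(1 / 18 / n)) ^ S.card := by
          have hle : (gaussianReal 0 1).real (Set.Ici u) ≤ 1 := measureReal_le_one
          refine pow_le_pow_left₀ (by linarith) ?_ _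
          linarith [Real.add_one_le_exp (-(1 / 18 / n))]
      _ = Real.exp (-(1 / 18)) := by
          rw [← Real.exp_nat_mul, hcard]; congr 1; field_simp
      _ ≤ 18 / 19 := by
          rw [Real.exp_neg, inv_le_comm₀ (by positivity) (by norm_num)]
          linarith [Real.add_one_le_exp (1 / 18 : ℝ)]
  have hPBc : 1 / 19 ≤ μ.real Bᶜ := by
    rw [measureReal_compl₀ hBm]
    simp only [probReal_univ]
    linarith
  have hpt : ∀ ω, Bᶜ.indicator (fun _ => u * decrRearr a l) ω
      ≤ ellNorm ∞ (fun i => a i * h i ω) := by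
    intro ω
    by_cases hω : ω ∈ Bᶜ
    · rw [Set.indicator_of_mem hω]
      simp only [hB, Set.mem_compl_iff, Set.mem_iInter, not_forall, Set.mem_preimage,
        Set.mem_Iio, not_lt] at hω
      obtain ⟨i, hi, hui⟩ := hω
      simp only [hS, Finset.mem_map, Finset.mem_Iic] at hi
      obtain ⟨i', hi', rfl⟩ := hi
      refine le_trans ?_ (abs_le_ellNorm (by simp) (fun i => a i * h i ω) (σ i'))
      rw [abs_mul, mul_comm]
      exact mul_le_mul (decrRearr_le_of_le a hi') (hui.trans (le_abs_self _)) hu0 (abs_nonneg _)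
    · rw [Set.indicator_of_notMem hω]
      exact ellNorm_nonneg (by simp) _
  have hfin : u * decrRearr a l * μ.real Bᶜ ≤ ∫ ω, ellNorm ∞ (fun i => a i * h i ω) ∂μ := by
    have e : ∫ ω, Bᶜ.indicator (fun _ => u * decrRearr a l) ω ∂μ
        = u * decrRearr a l * μ.real Bᶜ := by
      rw [integral_indicator₀ hBm.compl, setIntegral_const, smul_eq_mul, mul_comm]
    rw [← e]
    exact integral_mono ((integrable_const _).indicator₀ hBm.compl)
      (integrable_ellNorm_gaussian (by simp) hh) hpt
  have := mul_le_mul_of_nonneg_left hPBc (mul_nonneg hu0 (decrRearr_nonneg a l))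
  linarith

end Rearrangement

/-! ### Structured Gaussian matrices: integrability and laws. -/

section GaussianMatrix

variable {m n : ℕ} {Ω : Type*} [MeasurableSpace Ω] {μ : Measure Ω} {g : Fin m → Fin n → Ω → ℝ}

namespace IsIIDStdGaussian

lemma hasLaw_pi (hg : IsIIDStdGaussian g μ) :
    HasLaw (fun ω (ij : Fin m × Fin n) => g ij.1 ij.2 ω) (gaussPi (Fin m × Fin n)) μ :=
  hg.indep.hasLaw_pi fun ij => hg.hasLaw ij.1 ij.2

lemma swap (hg : IsIIDStdGaussian g μ) : IsIIDStdGaussian (fun j i => g i j) μ where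
  hasLaw j i := hg.hasLaw i j
  indep := hg.indep.precomp (g := Prod.swap) Prod.swap_injective

lemma col (hg : IsIIDStdGaussian g μ) (j : Fin n) : iIndepFun (fun i => g i j) μ :=
  hg.indep.precomp (g := fun i => (i, j)) fun _ _ h => congrArg Prod.fst h

lemma integrable_mul (hg : IsIIDStdGaussian g μ) (A : Matrix (Fin m) (Fin n) ℝ) (i : Fin m)
    (j : Fin n) : Integrable (fun ω => A i j * g i j ω) μ :=
  (integrable_of_hasLaw_gaussian (hg.hasLaw i j) integrable_id_gaussianReal_std).const_mul _

lemma aemeasurable_ellOpNorm (hg : IsIIDStdGaussian g μ) {p q : ℝ≥0∞} (hp : 0 < p) (hq : 1 ≤ q)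
    (A : Matrix (Fin m) (Fin n) ℝ) :
    AEMeasurable (fun ω => ellOpNorm p q (structuredMatrix A g ω)) μ := by
  have h : AEMeasurable (fun ω (ij : Fin m × Fin n) => A ij.1 ij.2 * g ij.1 ij.2 ω) μ :=
    aemeasurable_pi_lambda _ fun ij => (hg.integrable_mul A ij.1 ij.2).aemeasurable
  have h2 := (measurable_ellOpNorm hp hq).comp_aemeasurable h
  simp only [Function.comp_def] at h2
  simp only [structuredMatrix]
  exact h2

lemma integrable_ellOpNorm (hg : IsIIDStdGaussian g μ) {p q : ℝ≥0∞} (hp : 0 < p) (hq : 1 ≤ q)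
    (A : Matrix (Fin m) (Fin n) ℝ) :
    Integrable (fun ω => ellOpNorm p q (structuredMatrix A g ω)) μ := by
  refine Integrable.mono' (g := fun ω => ∑ i, ∑ j, |A i j * g i j ω|)
    (integrable_finsetSum _ fun i _ => integrable_finsetSum _ fun j _ =>
      (hg.integrable_mul A i j).abs)
    (hg.aemeasurable_ellOpNorm hp hq A).aestronglyMeasurable (.of_forall fun ω => ?_)
  rw [Real.norm_of_nonneg (ellOpNorm_nonneg (zero_lt_one.trans_le hq) _)]
  exact ellOpNorm_le_sum hp hq _

/-- The expected operator norm depends only on the law of the Gaussian family. -/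
lemma integral_ellOpNorm_eq {Ω' : Type*} [MeasurableSpace Ω'] {μ' : Measure Ω'}
    {g' : Fin m → Fin n → Ω' → ℝ} (hg : IsIIDStdGaussian g μ) (hg' : IsIIDStdGaussian g' μ')
    {p q : ℝ≥0∞} (hp : 0 < p) (hq : 1 ≤ q) (A : Matrix (Fin m) (Fin n) ℝ) :
    ∫ ω, ellOpNorm p q (structuredMatrix A g ω) ∂μ
      = ∫ ω, ellOpNorm p q (structuredMatrix A g' ω) ∂μ' := by
  set F : (Fin m × Fin n → ℝ) → ℝ := fun x =>
    ellOpNorm p q (Matrix.of fun i j => A i j * x (i, j)) with hF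
  have hm : Measurable F := by
    have h := (measurable_ellOpNorm (m := m) (n := n) hp hq).comp
      (by fun_prop : Measurable fun (x : Fin m × Fin n → ℝ) (ij : Fin m × Fin n) =>
        A ij.1 ij.2 * x ij)
    simp only [Function.comp_def] at h
    exact h
  have h1 := hg.hasLaw_pi.integral_comp hm.aestronglyMeasurable
  have h2 := hg'.hasLaw_pi.integral_comp hm.aestronglyMeasurable
  simp only [Function.comp_def, hF] at h1 h2
  simp only [structuredMatrix]
  exact h1.trans h2.symm

/-- Normalized linear combinations of the columns are iid standard Gaussians. -/
lemma combination (hg : IsIIDStdGaussian g μ) {τ : Fin n → ℝ} (hτ : ∑ j, τ j ^ 2 = 1) :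
    (∀ i, HasLaw (fun ω => ∑ j, τ j * g i j ω) (gaussianReal 0 1) μ) ∧
      iIndepFun (fun i ω => ∑ j, τ j * g i j ω) μ := by
  have hgauss : ∀ ij : Fin m × Fin n, HasGaussianLaw (g ij.1 ij.2) μ := fun ij =>
    (hg.hasLaw ij.1 ij.2).hasGaussianLaw
  have hjoint : HasGaussianLaw (fun ω (ij : Fin m × Fin n) => g ij.1 ij.2 ω) μ :=
    hg.indep.hasGaussianLaw hgauss
  have := hg.indep.isProbabilityMeasure
  let L : (Fin m × Fin n → ℝ) →L[ℝ] (Fin m → ℝ) :=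
    ContinuousLinearMap.pi fun i => ∑ j, τ j • ContinuousLinearMap.proj (R := ℝ) (i, j)
  have hL : ∀ ω, L (fun ij => g ij.1 ij.2 ω) = fun i => ∑ j, τ j * g i j ω := by
    intro ω; ext i; simp [L]
  have hcomb : HasGaussianLaw (fun ω i => ∑ j, τ j * g i j ω) μ := by
    have := hjoint.map_fun L
    simpa only [hL] using this
  have hmem : ∀ i j, MemLp (fun ω => τ j * g i j ω) 2 μ := fun i j =>
    (hgauss (i, j)).memLp_two.const_mul _
  -- The combinations are jointly Gaussian with identity covariance, so uncorrelated means
  -- independent.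
  have hcov : ∀ i i', cov[fun ω => ∑ j, τ j * g i j ω, fun ω => ∑ j, τ j * g i' j ω; μ]
      = if i = i' then 1 else 0 := by
    intro i i'
    rw [covariance_fun_sum_fun_sum (hmem i) (hmem i')]
    simp only [covariance_const_mul_left, covariance_const_mul_right]
    have hc : ∀ j j', cov[g i j, g i' j'; μ] = if (i, j) = (i', j') then 1 else 0 := by
      intro j j'
      by_cases h : (i, j) = (i', j')
      · rw [if_pos h]
        obtain ⟨rfl, rfl⟩ := Prod.mk.inj h
        rw [covariance_self (hgauss (i, j)).aemeasurable, (hg.hasLaw i j).variance_eq,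
          variance_id_gaussianReal]
        simp
      · rw [if_neg h]
        exact (hg.indep.indepFun h).covariance_eq_zero (hgauss (i, j)).memLp_two
          (hgauss (i', j')).memLp_two
    simp only [hc, Prod.mk.injEq]
    by_cases h : i = i'
    · simp only [h, true_and, if_true, mul_ite, mul_one, mul_zero, Finset.sum_ite_eq,
        Finset.mem_univ, ← sq, hτ]
    · simp [h]
  refine ⟨fun i => ?_, hcomb.iIndepFun_of_covariance_eq_zero fun i i' h => by
    rw [hcov, if_neg h]⟩
  have hi : HasGaussianLaw (fun ω => ∑ j, τ j * g i j ω) μ := hcomb.eval i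
  refine ⟨hi.aemeasurable, ?_⟩
  rw [hi.map_eq_gaussianReal]
  have hmean : ∫ ω, ∑ j, τ j * g i j ω ∂μ = 0 := by
    rw [integral_finsetSum _ fun j _ => (integrable_of_hasLaw_gaussian (hg.hasLaw i j)
      integrable_id_gaussianReal_std).const_mul _]
    refine Finset.sum_eq_zero fun j _ => ?_
    rw [integral_const_mul, integral_of_hasLaw_gaussian (f := fun x => x) (hg.hasLaw i j)
      integrable_id_gaussianReal_std, integral_id_gaussianReal, mul_zero]
  have hvar : Var[fun ω => ∑ j, τ j * g i j ω; μ] = 1 := by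
    rw [← covariance_self hi.aemeasurable, hcov, if_pos rfl]
  rw [hmean, hvar, Real.toNNReal_one]

end IsIIDStdGaussian

/-! ### Lower bounds from fixed test vectors. -/

section LowerBounds

variable {A : Matrix (Fin m) (Fin n) ℝ} {a : Fin m → ℝ} {b : Fin n → ℝ} {p q : ℝ≥0∞}

/-- Evaluating `G_A` at a fixed vector gives a vector of independent Gaussians. -/
lemma exists_gaussian_le_integral_ellOpNorm (hp : 1 ≤ p) (hq : 1 ≤ q)
    (hA : ∀ i j, A i j = a i * b j) (hg : IsIIDStdGaussian g μ) {t : Fin n → ℝ}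
    (ht : ellNorm p t ≤ 1) (hpos : 0 < √(∑ j, (b j * t j) ^ 2)) :
    ∃ h : Fin m → Ω → ℝ, (∀ i, HasLaw (h i) (gaussianReal 0 1) μ) ∧ iIndepFun h μ ∧
      √(∑ j, (b j * t j) ^ 2) * ∫ ω, ellNorm q (fun i => a i * h i ω) ∂μ
        ≤ ∫ ω, ellOpNorm p q (structuredMatrix A g ω) ∂μ := by
  have hp0 : 0 < p := zero_lt_one.trans_le hp
  have hq0 : 0 < q := zero_lt_one.trans_le hq
  have := hg.indep.isProbabilityMeasure
  set v := √(∑ j, (b j * t j) ^ 2)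
  have hv2 : v ^ 2 = ∑ j, (b j * t j) ^ 2 :=
    Real.sq_sqrt (Finset.sum_nonneg fun j _ => sq_nonneg _)
  -- With these weights, h_i = Σ_j (b_j t_j / v) g_ij is standard and (G_A t)_i = v a_i h_i.
  have hτ : ∑ j, (b j * t j / v) ^ 2 = 1 := by
    simp only [div_pow, ← Finset.sum_div]
    rw [← hv2]; exact div_self (by positivity)
  obtain ⟨h1, h2⟩ := hg.combination hτ
  refine ⟨_, h1, h2, ?_⟩
  rw [← integral_const_mul]
  refine integral_mono ((integrable_ellNorm_gaussian hq h1).const_mul v)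
    (hg.integrable_ellOpNorm hp0 hq A) fun ω => ?_
  refine le_trans (le_of_eq ?_) (ellNorm_mulVec_le hp0 hq0 _ ht)
  simp only
  rw [← abs_of_pos hpos, ← ellNorm_const_mul hq0, abs_of_pos hpos]
  congr 1; ext i
  simp only [structuredMatrix, Matrix.mulVec, dotProduct, Matrix.of_apply, hA, Finset.mul_sum]
  refine Finset.sum_congr rfl fun j _ => ?_
  field_simp

lemma integral_ellOpNorm_nonneg (hq : 0 < q) (A : Matrix (Fin m) (Fin n) ℝ) :
    0 ≤ ∫ ω, ellOpNorm p q (structuredMatrix A g ω) ∂μ :=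
  integral_nonneg fun _ => ellOpNorm_nonneg hq _

/-- Vectors t with all b_j t_j = 0 cannot be normalized; they add nothing to the supremum and are
split off here. -/
lemma mul_diagNorm_le {c : ℝ} (hp : 0 < p) (hc : 0 ≤ c) {E : ℝ} (hE : 0 ≤ E)
    (h : ∀ t, ellNorm p t ≤ 1 → 0 < √(∑ j, (b j * t j) ^ 2) →
      c * √(∑ j, (b j * t j) ^ 2) ≤ E) : c * diagNorm p b ≤ E := by
  rcases hc.eq_or_lt with rfl | hc
  · simpa using hE
  rw [← le_div_iff₀' hc]
  refine diagNorm_le hp fun t ht => ?_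
  rw [le_div_iff₀' hc]
  rcases (Real.sqrt_nonneg (∑ j, (b j * t j) ^ 2)).eq_or_lt with h0 | h0
  · rw [← h0]; simpa using hE
  · exact h t ht h0

lemma D1_le_integral_ellOpNorm (hp : 1 ≤ p) (hq : 1 ≤ q) (hA : ∀ i j, A i j = a i * b j)
    (hg : IsIIDStdGaussian g μ) :
    1 / 27 * D1 p q A ≤ ∫ ω, ellOpNorm p q (structuredMatrix A g ω) ∂μ := by
  have hp0 : 0 < p := zero_lt_one.trans_le hp
  have hq0 : 0 < q := zero_lt_one.trans_le hq
  rw [D1_eq_of_tensor hp0 hq0 hA, ← mul_assoc]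
  refine mul_diagNorm_le hp0 (mul_nonneg (by norm_num) (ellNorm_nonneg hq0 a))
    (integral_ellOpNorm_nonneg hq0 A) fun t ht hpos => ?_
  have := hg.indep.isProbabilityMeasure
  obtain ⟨h, h1, -, h3⟩ := exists_gaussian_le_integral_ellOpNorm hp hq hA hg ht hpos
  refine le_trans ?_ h3
  rw [mul_comm]
  exact mul_le_mul_of_nonneg_left (le_integral_ellNorm_gaussian hq h1) hpos.le

/-- At a fixed t the ℓ_q norm dominates the largest coordinate, whose independent Gaussian factors
produce the logarithms. For 2 ≤ p ≤ q this is the D₃ bound, and its transpose serves p ≤ q ≤ 2. -/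
lemma rearrMax_mul_diagNorm_le_integral_ellOpNorm (hp : 1 ≤ p) (hq : 1 ≤ q)
    (hA : ∀ i j, A i j = a i * b j) (hg : IsIIDStdGaussian g μ) :
    1 / 19 * rearrMax a * diagNorm p b
      ≤ ∫ ω, ellOpNorm p q (structuredMatrix A g ω) ∂μ := by
  have hp0 : 0 < p := zero_lt_one.trans_le hp
  have hq0 : 0 < q := zero_lt_one.trans_le hq
  refine mul_diagNorm_le hp0 (mul_nonneg (by norm_num) (rearrMax_nonneg a))
    (integral_ellOpNorm_nonneg hq0 A) fun t ht hpos => ?_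
  have := hg.indep.isProbabilityMeasure
  obtain ⟨h, h1, h2, h3⟩ := exists_gaussian_le_integral_ellOpNorm hp hq hA hg ht hpos
  refine le_trans ?_ h3
  rw [mul_comm]
  refine mul_le_mul_of_nonneg_left ?_ hpos.le
  refine (le_integral_ellNorm_top_gaussian a h1 h2).trans ?_
  exact integral_mono (integrable_ellNorm_gaussian (by simp) h1)
    (integrable_ellNorm_gaussian hq h1) fun ω => ellNorm_top_le hq0 _

lemma integrable_iSup_entries (hg : IsIIDStdGaussian g μ) (A : Matrix (Fin m) (Fin n) ℝ) :
    Integrable (fun ω => ⨆ ij : Fin m × Fin n, |A ij.1 ij.2 * g ij.1 ij.2 ω|) μ := by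
  have hi : ∀ ij : Fin m × Fin n, Integrable (fun ω => |A ij.1 ij.2 * g ij.1 ij.2 ω|) μ :=
    fun ij => (hg.integrable_mul A ij.1 ij.2).abs
  have hm := AEMeasurable.iSup fun ij => (hi ij).aemeasurable
  refine Integrable.mono' (g := fun ω => ∑ ij : Fin m × Fin n, |A ij.1 ij.2 * g ij.1 ij.2 ω|)
    (integrable_finsetSum _ fun ij _ => hi ij) hm.aestronglyMeasurable
    (.of_forall fun ω => ?_)
  rw [Real.norm_of_nonneg (Real.iSup_nonneg fun _ => abs_nonneg _)]
  exact Real.iSup_le (fun ij => Finset.single_le_sum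
    (f := fun ij : Fin m × Fin n => |A ij.1 ij.2 * g ij.1 ij.2 ω|) (fun _ _ => abs_nonneg _)
    (Finset.mem_univ ij)) (Finset.sum_nonneg fun _ _ => abs_nonneg _)

/-- Entry (i, j) is coordinate i of the image of the j-th unit vector. -/
lemma integral_iSup_entries_le (hp : 1 ≤ p) (hq : 1 ≤ q) (hg : IsIIDStdGaussian g μ)
    (A : Matrix (Fin m) (Fin n) ℝ) :
    ∫ ω, ⨆ ij : Fin m × Fin n, |A ij.1 ij.2 * g ij.1 ij.2 ω| ∂μ
      ≤ ∫ ω, ellOpNorm p q (structuredMatrix A g ω) ∂μ := by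
  have hp0 : 0 < p := zero_lt_one.trans_le hp
  have hq0 : 0 < q := zero_lt_one.trans_le hq
  refine integral_mono (integrable_iSup_entries hg A) (hg.integrable_ellOpNorm hp0 hq A)
    fun ω => Real.iSup_le (fun ij => ?_) (ellOpNorm_nonneg hq0 _)
  have h1 : ellNorm p (Pi.single ij.2 1 : Fin n → ℝ) ≤ 1 := by
    rw [ellNorm_single hp0]; simp
  have h2 := abs_le_ellNorm hq0 ((structuredMatrix A g ω).mulVec (Pi.single ij.2 1)) ij.1
  have h3 := ellNorm_mulVec_le hp0 hq0 (structuredMatrix A g ω) h1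
  refine le_trans (le_of_eq ?_) (h2.trans h3)
  simp [structuredMatrix]

/-- The maximal entry of one column of `G_A`. -/
lemma mul_rearrMax_le_integral_iSup_entries (hA : ∀ i j, A i j = a i * b j)
    (hg : IsIIDStdGaussian g μ) (j : Fin n) :
    |b j| * (1 / 19 * rearrMax a)
      ≤ ∫ ω, ⨆ ij : Fin m × Fin n, |A ij.1 ij.2 * g ij.1 ij.2 ω| ∂μ := by
  have := hg.indep.isProbabilityMeasure
  have h1 := le_integral_ellNorm_top_gaussian a (fun i => hg.hasLaw i j) (hg.col j)
  refine (mul_le_mul_of_nonneg_left h1 (abs_nonneg (b j))).trans ?_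
  rw [← integral_const_mul]
  refine integral_mono ((integrable_ellNorm_gaussian (by simp) fun i =>
    hg.hasLaw i j).const_mul _) (integrable_iSup_entries hg A) fun ω => ?_
  simp only
  rw [ellNorm_top, Real.mul_iSup_of_nonneg (abs_nonneg _)]
  refine Real.iSup_le (fun i => ?_) (Real.iSup_nonneg fun _ => abs_nonneg _)
  refine le_trans (le_of_eq ?_)
    (le_iSup_fintype (fun ij : Fin m × Fin n => |A ij.1 ij.2 * g ij.1 ij.2 ω|) (i, j))
  rw [hA, ← abs_mul]; congr 1; ring

end LowerBounds

/-! ### Chevet's inequality. -/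

section Chevet

variable {A : Matrix (Fin m) (Fin n) ℝ} {a : Fin m → ℝ} {b : Fin n → ℝ}

/-- The index set of the Gaussian matrix and of the two Gaussian vectors in Chevet's inequality. -/
abbrev ChevetIndex (m n : ℕ) : Type := (Fin m × Fin n) ⊕ (Fin m ⊕ Fin n)

lemma hasLaw_eval_gaussPi {ι : Type*} [Fintype ι] (k : ι) :
    HasLaw (fun g : ι → ℝ => g k) (gaussianReal 0 1) (gaussPi ι) :=
  (measurePreserving_eval (fun _ : ι => gaussianReal 0 1) k).hasLaw

lemma isIIDStdGaussian_chevetIndex :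
    IsIIDStdGaussian (fun (i : Fin m) (j : Fin n) (g : ChevetIndex m n → ℝ) => g (.inl (i, j)))
      (gaussPi (ChevetIndex m n)) where
  hasLaw i j := hasLaw_eval_gaussPi _
  indep := by
    have h : iIndepFun (fun (k : ChevetIndex m n) (g : ChevetIndex m n → ℝ) => g k)
        (gaussPi (ChevetIndex m n)) :=
      iIndepFun_pi (X := fun _ x => x) fun _ => aemeasurable_id
    exact h.precomp (g := Sum.inl) Sum.inl_injective

lemma abs_mul_sub_mul_le {s t s' t' ε : ℝ} (hs : |s| ≤ 1) (ht : |t'| ≤ 1) (h1 : |s - s'| ≤ ε)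
    (h2 : |t - t'| ≤ ε) : |s * t - s' * t'| ≤ 2 * ε := by
  have e : s * t - s' * t' = s * (t - t') + (s - s') * t' := by ring
  rw [e]
  refine (abs_add_le _ _).trans ?_
  rw [abs_mul, abs_mul]
  nlinarith [abs_nonneg (t - t'), abs_nonneg (s - s'), abs_nonneg s, abs_nonneg t']

/-- The operator norm is approximated by the maximum of the bilinear form on a finite set. -/
lemma exists_finite_net (p p' q q' : ℝ≥0∞) [hp : p.HolderConjugate p'] [hq : q.HolderConjugate q']
    (m n : ℕ) {ε : ℝ} (hε : 0 < ε) :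
    ∃ T : Finset ((Fin n → ℝ) × (Fin m → ℝ)), T.Nonempty ∧
      (∀ z ∈ T, ellNorm p z.1 ≤ 1 ∧ ellNorm q' z.2 ≤ 1) ∧
      ∀ X : Matrix (Fin m) (Fin n) ℝ, ellOpNorm p q X
        ≤ (⨆ z : T, ∑ i, ∑ j, z.1.2 i * z.1.1 j * X i j) + 2 * ε * ∑ i, ∑ j, |X i j| := by
  have hp0 : 0 < p := ENNReal.HolderConjugate.pos p p'
  have hq0 : 0 < q' := by have := hq.symm; exact ENNReal.HolderConjugate.pos q' q
  set S : Set ((Fin n → ℝ) × (Fin m → ℝ)) := {z | ellNorm p z.1 ≤ 1 ∧ ellNorm q' z.2 ≤ 1}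
    with hS
  have hcoord1 : ∀ z ∈ S, ∀ j, |z.1 j| ≤ 1 := fun z hz j => (abs_le_ellNorm hp0 _ j).trans hz.1
  have hcoord2 : ∀ z ∈ S, ∀ i, |z.2 i| ≤ 1 := fun z hz i => (abs_le_ellNorm hq0 _ i).trans hz.2
  have htb : TotallyBounded S := by
    refine ((isCompact_closedBall (0 : (Fin n → ℝ) × (Fin m → ℝ)) 1).totallyBounded).subset ?_
    intro z hz
    rw [mem_closedBall_zero_iff, Prod.norm_def, max_le_iff, pi_norm_le_iff_of_nonneg zero_le_one,
      pi_norm_le_iff_of_nonneg zero_le_one]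
    exact ⟨hcoord1 z hz, hcoord2 z hz⟩
  -- The net depends on ε and not on X, so one finite family serves all realizations of the random
  -- matrix.
  obtain ⟨T, hTS, hTf, hcov⟩ := Metric.finite_approx_of_totallyBounded htb ε hε
  have h0S : (0 : (Fin n → ℝ) × (Fin m → ℝ)) ∈ S :=
    ⟨by simp [ellNorm_zero hp0], by simp [ellNorm_zero hq0]⟩
  have hfind : ∀ z ∈ S, ∃ y ∈ T, dist z y < ε := fun z hz => by
    simpa using hcov hz
  refine ⟨hTf.toFinset, ?_, fun z hz => hTS (hTf.mem_toFinset.1 hz), fun X => ?_⟩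
  · obtain ⟨y, hy, -⟩ := hfind 0 h0S
    exact ⟨y, hTf.mem_toFinset.2 hy⟩
  · refine ellOpNorm_le hp0 fun t ht => ?_
    obtain ⟨s, hs, hst⟩ := exists_sum_mul_eq_ellNorm q q' (X.mulVec t)
    have hzS : (t, s) ∈ S := ⟨ht, hs⟩
    obtain ⟨y, hy, hdist⟩ := hfind (t, s) hzS
    have hyS := hTS hy
    rw [Prod.dist_eq, max_lt_iff] at hdist
    have hd1 : ∀ j, |t j - y.1 j| ≤ ε := fun j => (dist_le_pi_dist t y.1 j).trans hdist.1.le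
    have hd2 : ∀ i, |s i - y.2 i| ≤ ε := fun i => (dist_le_pi_dist s y.2 i).trans hdist.2.le
    have hle := le_iSup_fintype
      (fun z : hTf.toFinset => ∑ i, ∑ j, z.1.2 i * z.1.1 j * X i j)
      ⟨y, hTf.mem_toFinset.2 hy⟩
    rw [← hst]
    have e : ∑ i, X.mulVec t i * s i = ∑ i, ∑ j, y.2 i * y.1 j * X i j
        + ∑ i, ∑ j, (s i * t j - y.2 i * y.1 j) * X i j := by
      simp only [← Finset.sum_add_distrib, Matrix.mulVec, dotProduct, Finset.sum_mul]
      exact Finset.sum_congr rfl fun i _ => Finset.sum_congr rfl fun j _ => by ring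
    rw [e]
    refine add_le_add hle ?_
    simp only [Finset.mul_sum]
    refine Finset.sum_le_sum fun i _ => Finset.sum_le_sum fun j _ => ?_
    refine (le_abs_self _).trans ?_
    rw [abs_mul]
    refine mul_le_mul_of_nonneg_right ?_ (abs_nonneg _)
    exact abs_mul_sub_mul_le (hcoord2 _ hzS i) (hcoord1 _ hyS j) (hd2 i) (hd1 j)

/-- Chevet's inequality for a finite set of pairs of vectors. -/
lemma chevet_finite {p p' q q' : ℝ≥0∞} [hp : p.HolderConjugate p'] [hq : q.HolderConjugate q']
    (a : Fin m → ℝ) (b : Fin n → ℝ)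
    {T : Finset ((Fin n → ℝ) × (Fin m → ℝ))} (hT : T.Nonempty)
    (hTS : ∀ z ∈ T, ellNorm p z.1 ≤ 1 ∧ ellNorm q' z.2 ≤ 1) :
    ∫ g, ⨆ z : T, ∑ i, ∑ j, z.1.2 i * z.1.1 j * (a i * b j * g (.inl (i, j)))
        ∂(gaussPi (ChevetIndex m n))
      ≤ √2 * (diagNorm p b
          * ∫ g, ellNorm q (fun i => a i * g (.inr (.inl i))) ∂(gaussPi (ChevetIndex m n))
        + diagNorm q' a
          * ∫ g, ellNorm p' (fun j => b j * g (.inr (.inr j))) ∂(gaussPi (ChevetIndex m n))) := by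
  have hp0 : 0 < p := ENNReal.HolderConjugate.pos p p'
  have hq0' : 0 < q' := by have := hq.symm; exact ENNReal.HolderConjugate.pos q' q
  have hp1' : 1 ≤ p' := by have := hp.symm; exact ENNReal.HolderConjugate.one_le p' p
  have hq1 : 1 ≤ q := ENNReal.HolderConjugate.one_le q q'
  set N := diagNorm p b
  set M := diagNorm q' a
  have hN : 0 ≤ N := diagNorm_nonneg p b
  have hM : 0 ≤ M := diagNorm_nonneg q' a
  have : Nonempty T := hT.to_subtype
  -- The families `x` and `y` occupy disjoint blocks of coordinates, which gives the orthogonality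
  -- needed for the comparison.
  set x : T → ChevetIndex m n → ℝ := fun z =>
    Sum.elim (fun ij => a ij.1 * z.1.2 ij.1 * (b ij.2 * z.1.1 ij.2)) 0 with hx
  set y : T → ChevetIndex m n → ℝ := fun z =>
    Sum.elim 0 (Sum.elim (fun i => √2 * N * (a i * z.1.2 i)) fun j => √2 * M * (b j * z.1.1 j))
    with hy
  have hSF := sudakov_fernique (x := x) (y := y) (fun t s => by simp [hx, hy]) fun z w => by
    have h2 : √2 ^ 2 = (2 : ℝ) := Real.sq_sqrt (by norm_num)
    have hb : ∑ j, (b j * z.1.1 j) ^ 2 ≤ N ^ 2 := sum_sq_le_diagNorm_sq hp0 b (hTS z.1 z.2).1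
    have ha : ∑ i, (a i * w.1.2 i) ^ 2 ≤ M ^ 2 := sum_sq_le_diagNorm_sq hq0' a (hTS w.1 w.2).2
    simp only [hx, hy, Fintype.sum_sum_type, Sum.elim_inl, Sum.elim_inr, Pi.zero_apply, sub_self,
      ne_eq, OfNat.ofNat_ne_zero, not_false_eq_true, zero_pow, Finset.sum_const_zero, add_zero,
      zero_add, ← mul_sub (√2 * _), mul_pow _ (_ - _), ← Finset.mul_sum, mul_pow √2, h2]
    rw [Fintype.sum_prod_type]
    -- The bound (αβ - α'β')² ≤ 2(α - α')²β² + 2α'²(β - β')² separates the two variables; its factor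
    -- 2 is the square of the √2 in `y`.
    calc ∑ i, ∑ j, (a i * z.1.2 i * (b j * z.1.1 j) - a i * w.1.2 i * (b j * w.1.1 j)) ^ 2
        ≤ ∑ i, ∑ j, (2 * ((a i * z.1.2 i - a i * w.1.2 i) ^ 2 * (b j * z.1.1 j) ^ 2)
            + 2 * ((a i * w.1.2 i) ^ 2 * (b j * z.1.1 j - b j * w.1.1 j) ^ 2)) := by
          refine Finset.sum_le_sum fun i _ => Finset.sum_le_sum fun j _ => ?_
          nlinarith [sq_nonneg ((a i * z.1.2 i - a i * w.1.2 i) * (b j * z.1.1 j)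
            - (a i * w.1.2 i) * (b j * z.1.1 j - b j * w.1.1 j))]
      _ = 2 * ((∑ i, (a i * z.1.2 i - a i * w.1.2 i) ^ 2) * ∑ j, (b j * z.1.1 j) ^ 2)
            + 2 * ((∑ i, (a i * w.1.2 i) ^ 2) * ∑ j, (b j * z.1.1 j - b j * w.1.1 j) ^ 2) := by
          simp only [Finset.sum_add_distrib, ← Finset.mul_sum, Finset.sum_mul_sum]
      _ ≤ 2 * ((∑ i, (a i * z.1.2 i - a i * w.1.2 i) ^ 2) * N ^ 2)
            + 2 * (M ^ 2 * ∑ j, (b j * z.1.1 j - b j * w.1.1 j) ^ 2) := by gcongr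
      _ = _ := by ring
  have i1 : Integrable (fun g : ChevetIndex m n → ℝ =>
      ellNorm q fun i => a i * g (.inr (.inl i))) (gaussPi (ChevetIndex m n)) :=
    integrable_ellNorm_gaussian hq1 fun i => hasLaw_eval_gaussPi _
  have i2 : Integrable (fun g : ChevetIndex m n → ℝ =>
      ellNorm p' fun j => b j * g (.inr (.inr j))) (gaussPi (ChevetIndex m n)) :=
    integrable_ellNorm_gaussian hp1' fun i => hasLaw_eval_gaussPi _
  have ex : ∀ (g : ChevetIndex m n → ℝ) (z : T),
      ∑ i, ∑ j, z.1.2 i * z.1.1 j * (a i * b j * g (.inl (i, j))) = linForms x g z := by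
    intro g z
    simp only [linForms, hx, Fintype.sum_sum_type, Sum.elim_inl, Sum.elim_inr, Pi.zero_apply,
      zero_mul, Finset.sum_const_zero, add_zero]
    rw [Fintype.sum_prod_type]
    exact Finset.sum_congr rfl fun i _ => Finset.sum_congr rfl fun j _ => by ring
  simp only [ex]
  refine hSF.trans ?_
  calc ∫ g, ⨆ z, linForms y g z ∂(gaussPi (ChevetIndex m n))
      ≤ ∫ g : ChevetIndex m n → ℝ, √2 * (N * ellNorm q (fun i => a i * g (.inr (.inl i)))
          + M * ellNorm p' (fun j => b j * g (.inr (.inr j)))) ∂(gaussPi (ChevetIndex m n)) := by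
        refine integral_mono (integrable_iSup_linForms y)
          (((i1.const_mul N).add (i2.const_mul M)).const_mul √2) fun g => ciSup_le fun z => ?_
        have e : linForms y g z = √2 * (N * ∑ i, a i * g (.inr (.inl i)) * z.1.2 i
            + M * ∑ j, b j * g (.inr (.inr j)) * z.1.1 j) := by
          simp only [linForms, hy, Fintype.sum_sum_type, Sum.elim_inl, Sum.elim_inr,
            Pi.zero_apply, zero_mul, Finset.sum_const_zero, zero_add, mul_add, Finset.mul_sum]
          congr 1 <;> exact Finset.sum_congr rfl fun i _ => by ring
        rw [e]
        have hz := hTS z.1 z.2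
        have := hp.symm
        gcongr
        · exact (le_abs_self _).trans ((abs_sum_mul_le_ellNorm q q' _ _).trans
            (mul_le_of_le_one_right (ellNorm_nonneg (zero_lt_one.trans_le hq1) _) hz.2))
        · exact (le_abs_self _).trans ((abs_sum_mul_le_ellNorm p' p _ _).trans
            (mul_le_of_le_one_right (ellNorm_nonneg (zero_lt_one.trans_le hp1') _) hz.1))
    _ = _ := by
        rw [integral_const_mul, integral_add (i1.const_mul N) (i2.const_mul M),
          integral_const_mul, integral_const_mul]

/-- **Chevet's inequality** for the structured Gaussian matrix of a tensor. -/
lemma chevet {p p' q q' : ℝ≥0∞} [hp : p.HolderConjugate p'] [hq : q.HolderConjugate q']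
    (hA : ∀ i j, A i j = a i * b j) (hg : IsIIDStdGaussian g μ) :
    ∫ ω, ellOpNorm p q (structuredMatrix A g ω) ∂μ
      ≤ √2 * (diagNorm p b
          * ∫ g, ellNorm q (fun i => a i * g (.inr (.inl i))) ∂(gaussPi (ChevetIndex m n))
        + diagNorm q' a
          * ∫ g, ellNorm p' (fun j => b j * g (.inr (.inr j))) ∂(gaussPi (ChevetIndex m n))) := by
  have hp0 : 0 < p := ENNReal.HolderConjugate.pos p p'
  have hq1 : 1 ≤ q := ENNReal.HolderConjugate.one_le q q'
  have hg' := isIIDStdGaussian_chevetIndex (m := m) (n := n)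
  -- The given probability space may not carry two further Gaussian vectors; only the law matters,
  -- so a larger canonical space is used.
  rw [hg.integral_ellOpNorm_eq hg' hp0 hq1]
  set γ := gaussPi (ChevetIndex m n)
  set g' := fun (i : Fin m) (j : Fin n) (g : ChevetIndex m n → ℝ) => g (.inl (i, j))
  set K := ∑ i, ∑ j, ∫ ω, |A i j * g' i j ω| ∂γ
  have hK : 0 ≤ K := Finset.sum_nonneg fun i _ => Finset.sum_nonneg fun j _ =>
    integral_nonneg fun _ => abs_nonneg _
  refine le_of_forall_pos_le_add fun δ hδ => ?_
  -- This ε makes the expected net error at most δ; K + 1 replaces K because K may vanish.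
  obtain ⟨T, hT, hTS, hX⟩ := exists_finite_net p p' q q' m n
    (ε := δ / (2 * (K + 1))) (by positivity)
  have hfin := chevet_finite (p := p) (p' := p') (q := q) (q' := q') a b hT hTS
  simp only [← hA] at hfin
  have iA : ∀ i j, Integrable (fun ω => |A i j * g' i j ω|) γ := fun i j =>
    (hg'.integrable_mul A i j).abs
  have iS : Integrable (fun ω => ∑ i, ∑ j, |A i j * g' i j ω|) γ :=
    integrable_finsetSum _ fun i _ => integrable_finsetSum _ fun j _ => iA i j
  have iT : Integrable
      (fun ω => ⨆ z : T, ∑ i, ∑ j, z.1.2 i * z.1.1 j * (A i j * g' i j ω)) γ := by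
    have e : ∀ (ω : ChevetIndex m n → ℝ) (z : T),
        ∑ i, ∑ j, z.1.2 i * z.1.1 j * (A i j * g' i j ω)
        = linForms (fun z : T => Sum.elim
          (fun ij => z.1.2 ij.1 * z.1.1 ij.2 * A ij.1 ij.2) 0) ω z := by
      intro ω z
      simp only [linForms, Fintype.sum_sum_type, Sum.elim_inl, Sum.elim_inr, Pi.zero_apply,
        zero_mul, Finset.sum_const_zero, add_zero]
      rw [Fintype.sum_prod_type]
      exact Finset.sum_congr rfl fun i _ => Finset.sum_congr rfl fun j _ => by ring
    simp only [e]
    exact integrable_iSup_linForms _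
  calc ∫ ω, ellOpNorm p q (structuredMatrix A g' ω) ∂γ
      ≤ ∫ ω, ((⨆ z : T, ∑ i, ∑ j, z.1.2 i * z.1.1 j * (A i j * g' i j ω))
          + 2 * (δ / (2 * (K + 1))) * ∑ i, ∑ j, |A i j * g' i j ω|) ∂γ :=
        integral_mono (hg'.integrable_ellOpNorm hp0 hq1 A) (iT.add (iS.const_mul _))
          fun ω => hX _
    _ = ∫ ω, ⨆ z : T, ∑ i, ∑ j, z.1.2 i * z.1.1 j * (A i j * g' i j ω) ∂γ
          + 2 * (δ / (2 * (K + 1))) * K := by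
        rw [integral_add iT (iS.const_mul _), integral_const_mul,
          integral_finsetSum _ fun i _ => integrable_finsetSum _ fun j _ => iA i j]
        congr 2
        exact Finset.sum_congr rfl fun i _ => integral_finsetSum _ fun j _ => iA i j
    _ ≤ _ := by
        refine add_le_add hfin ?_
        have : 2 * (δ / (2 * (K + 1))) * K = δ * (K / (K + 1)) := by field_simp
        rw [this]
        exact mul_le_of_le_one_right hδ.le (div_le_one_of_le₀ (by linarith) (by linarith))

end Chevet

end GaussianMatrix

/-! ### Arithmetic of conjugate exponents. -/

section ConjugateExponents

lemma inv_eq_one_sub_inv_conjExponent {q : ℝ≥0∞} (hq : 1 ≤ q) :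
    q⁻¹ = 1 - q.conjExponent⁻¹ := by
  have := ENNReal.HolderConjugate.conjExponent hq
  refine ENNReal.eq_sub_of_add_eq ?_ (ENNReal.HolderConjugate.inv_add_inv_eq_one q q.conjExponent)
  exact ENNReal.inv_ne_top.2 (by
    have := this.symm
    exact (ENNReal.HolderConjugate.pos q.conjExponent q).ne')

lemma one_le_conjExponent {q : ℝ≥0∞} (hq : 1 ≤ q) : 1 ≤ q.conjExponent := by
  have := (ENNReal.HolderConjugate.conjExponent hq).symm
  exact ENNReal.HolderConjugate.one_le q.conjExponent q

lemma two_le_conjExponent {q : ℝ≥0∞} (hq : 1 ≤ q) (hq2 : q ≤ 2) : 2 ≤ q.conjExponent := by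
  have h := inv_eq_one_sub_inv_conjExponent hq
  rw [← ENNReal.inv_le_inv] at hq2 ⊢
  have h1 : q.conjExponent⁻¹ ≤ 1 := ENNReal.inv_le_one.2 (one_le_conjExponent hq)
  rw [h] at hq2
  rw [← ENNReal.one_sub_inv_two]
  refine ENNReal.le_sub_of_add_le_right (by simp) ?_
  rw [add_comm]
  exact (add_le_add_left hq2 _).trans (tsub_add_cancel_of_le h1).le

lemma conjExponent_le_two {q : ℝ≥0∞} (hq : 1 ≤ q) (hq2 : 2 ≤ q) : q.conjExponent ≤ 2 := by
  have h := inv_eq_one_sub_inv_conjExponent hq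
  rw [← ENNReal.inv_le_inv] at hq2 ⊢
  rw [h] at hq2
  rw [← ENNReal.one_sub_inv_two, tsub_le_iff_left]
  rwa [tsub_le_iff_right] at hq2

/-- Column norms at q are therefore row norms of the transpose at q*, so the two logarithmic cases
of D₃ are dual. -/
lemma half_sub_inv_conjExponent {q : ℝ≥0∞} (hq : 1 ≤ q) :
    2⁻¹ - q.conjExponent⁻¹ = q⁻¹ - 2⁻¹ := by
  rw [inv_eq_one_sub_inv_conjExponent hq, tsub_right_comm, ENNReal.one_sub_inv_two]

end ConjugateExponents

/-! ### Duality for D₂ and D₃, and the final bounds. -/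

section Assembly

variable {m n : ℕ} {Ω : Type*} [MeasurableSpace Ω] {μ : Measure Ω} {g : Fin m → Fin n → Ω → ℝ}
  {A : Matrix (Fin m) (Fin n) ℝ} {a : Fin m → ℝ} {b : Fin n → ℝ} {p q : ℝ≥0∞}

lemma integral_ellOpNorm_transpose (hp : 1 ≤ p) (hq : 1 ≤ q) :
    ∫ ω, ellOpNorm q.conjExponent p.conjExponent
        (structuredMatrix A.transpose (fun j i => g i j) ω) ∂μ
      = ∫ ω, ellOpNorm p q (structuredMatrix A g ω) ∂μ := by
  have := ENNReal.HolderConjugate.conjExponent hp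
  have := ENNReal.HolderConjugate.conjExponent hq
  congr 1
  ext ω
  exact ellOpNorm_transpose p p.conjExponent q q.conjExponent (structuredMatrix A g ω)

lemma transpose_tensor (hA : ∀ i j, A i j = a i * b j) (j : Fin n) (i : Fin m) :
    A.transpose j i = b j * a i := by
  rw [Matrix.transpose_apply, hA, mul_comm]

lemma D2_eq_of_tensor (hp : 1 ≤ p) (hq : 1 ≤ q) (hA : ∀ i j, A i j = a i * b j) :
    D2 p q A = ellNorm p.conjExponent b * diagNorm q.conjExponent a := by
  rw [← D1_transpose]
  exact D1_eq_of_tensor (zero_lt_one.trans_le (one_le_conjExponent hq))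
    (zero_lt_one.trans_le (one_le_conjExponent hp)) (transpose_tensor hA)

lemma rearrMax_abs {k : ℕ} (a : Fin k → ℝ) : rearrMax (fun i => |a i|) = rearrMax a := by
  simp only [rearrMax, decrRearr, abs_abs]

lemma rearrMax_const_mul_abs {k : ℕ} {c : ℝ} (hc : 0 ≤ c) (a : Fin k → ℝ) :
    rearrMax (fun i => c * |a i|) = c * rearrMax a := by
  rw [rearrMax_const_mul, rearrMax_abs, abs_of_nonneg hc]

/-- `D₃` for a tensor in the case `2 ≤ p ≤ q`. -/
lemma rearrMax_rowNorm (hp : 2 ≤ p) (hA : ∀ i j, A i j = a i * b j) :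
    rearrMax (rowNorm p A) = diagNorm p b * rearrMax a := by
  rw [← rearrMax_const_mul_abs (diagNorm_nonneg p b)]
  congr 1; ext i
  have hr : 0 < (2⁻¹ - p⁻¹ : ℝ≥0∞)⁻¹ := by
    rw [ENNReal.inv_pos]; exact ENNReal.sub_ne_top (by simp)
  simp only [rowNorm, hA]
  rw [ellNorm_const_mul hr, diagNorm_eq_of_two_le hp, mul_comm]

/-- `D₃` for a tensor in the case `p ≤ q ≤ 2`. -/
lemma rearrMax_colNorm (hq : 1 ≤ q) (hq2 : q ≤ 2) (hA : ∀ i j, A i j = a i * b j) :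
    rearrMax (colNorm q A) = diagNorm q.conjExponent a * rearrMax b := by
  rw [← rearrMax_rowNorm (two_le_conjExponent hq hq2) (transpose_tensor hA)]
  congr 1; ext j
  rw [colNorm, rowNorm, half_sub_inv_conjExponent hq]
  rfl

lemma D3_nonneg (A : Matrix (Fin m) (Fin n) ℝ) (g : Fin m → Fin n → Ω → ℝ) :
    0 ≤ D3 p q A g μ := by
  unfold D3
  split_ifs
  · exact integral_nonneg fun ω => Real.iSup_nonneg fun _ => abs_nonneg _
  · exact rearrMax_nonneg _
  · exact rearrMax_nonneg _
  · exact le_rfl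

lemma D2_le_integral_ellOpNorm (hp : 1 ≤ p) (hq : 1 ≤ q) (hA : ∀ i j, A i j = a i * b j)
    (hg : IsIIDStdGaussian g μ) :
    1 / 27 * D2 p q A ≤ ∫ ω, ellOpNorm p q (structuredMatrix A g ω) ∂μ := by
  rw [← D1_transpose, ← integral_ellOpNorm_transpose hp hq]
  exact D1_le_integral_ellOpNorm (one_le_conjExponent hq) (one_le_conjExponent hp)
    (transpose_tensor hA) hg.swap

lemma D3_le_integral_ellOpNorm (hp : 1 ≤ p) (hq : 1 ≤ q) (hA : ∀ i j, A i j = a i * b j)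
    (hg : IsIIDStdGaussian g μ) :
    1 / 19 * D3 p q A g μ ≤ ∫ ω, ellOpNorm p q (structuredMatrix A g ω) ∂μ := by
  have hE := integral_ellOpNorm_nonneg (p := p) (μ := μ) (g := g) (zero_lt_one.trans_le hq) A
  unfold D3
  split_ifs with h1 h2 h3
  · have := integral_iSup_entries_le hp hq hg A
    linarith
  · change 1 / 19 * rearrMax (colNorm q A) ≤ _
    rw [rearrMax_colNorm hq h2.2 hA, mul_comm (diagNorm _ _), ← mul_assoc,
      ← integral_ellOpNorm_transpose hp hq]
    exact rearrMax_mul_diagNorm_le_integral_ellOpNorm (one_le_conjExponent hq)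
      (one_le_conjExponent hp) (transpose_tensor hA) hg.swap
  · change 1 / 19 * rearrMax (rowNorm p A) ≤ _
    rw [rearrMax_rowNorm h3.1 hA, mul_comm (diagNorm _ _), ← mul_assoc]
    exact rearrMax_mul_diagNorm_le_integral_ellOpNorm hp hq hA hg
  · simpa using hE

/-- For p ≤ 2 the diagonal factor is at most the largest |b_j|, and the column with that j alone has
a large enough expected maximum. -/
lemma diagNorm_mul_rearrMax_le_integral_iSup (hp : 1 ≤ p) (hp2 : p ≤ 2)
    (hA : ∀ i j, A i j = a i * b j) (hg : IsIIDStdGaussian g μ) :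
    diagNorm p b * rearrMax a
      ≤ 19 * ∫ ω, ⨆ ij : Fin m × Fin n, |A ij.1 ij.2 * g ij.1 ij.2 ω| ∂μ := by
  have hI : 0 ≤ ∫ ω, ⨆ ij : Fin m × Fin n, |A ij.1 ij.2 * g ij.1 ij.2 ω| ∂μ :=
    integral_nonneg fun ω => Real.iSup_nonneg fun _ => abs_nonneg _
  have hd := diagNorm_le_of_le_two (zero_lt_one.trans_le hp) hp2 b
  refine (mul_le_mul_of_nonneg_right hd (rearrMax_nonneg a)).trans ?_
  rcases isEmpty_or_nonempty (Fin n) with h | h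
  · rw [Real.iSup_of_isEmpty]; linarith
  · obtain ⟨j, hj⟩ := exists_eq_ciSup_of_finite (f := fun j => |b j|)
    rw [← hj]
    have := mul_rearrMax_le_integral_iSup_entries hA hg j
    linarith

/-- For `q = ∞` the diagonal factor in Chevet's inequality is controlled by `D₃`. -/
lemma diagNorm_mul_rearrMax_le_D3_top (hp : 1 ≤ p) (hA : ∀ i j, A i j = a i * b j)
    (hg : IsIIDStdGaussian g μ) :
    diagNorm p b * rearrMax a ≤ 19 * D3 p ∞ A g μ := by
  unfold D3
  split_ifs with h1 h2 h3
  · exact diagNorm_mul_rearrMax_le_integral_iSup hp h1.1 hA hg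
  · exact absurd h2.2 (by simp)
  · change _ ≤ 19 * rearrMax (rowNorm p A)
    rw [rearrMax_rowNorm h3.1 hA]
    have := mul_nonneg (diagNorm_nonneg p b) (rearrMax_nonneg a)
    linarith
  -- Every p satisfies p ≤ ∞, so the case D₃ = 0 cannot occur.
  · rcases le_total p 2 with h | h
    · exact absurd ⟨h, le_top⟩ h1
    · exact absurd ⟨h, le_top⟩ h3

/-- For `p = 1` the diagonal factor in Chevet's inequality is controlled by `D₃`. -/
lemma diagNorm_mul_rearrMax_le_D3_one (hq : 1 ≤ q) (hA : ∀ i j, A i j = a i * b j)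
    (hg : IsIIDStdGaussian g μ) :
    diagNorm q.conjExponent a * rearrMax b ≤ 19 * D3 1 q A g μ := by
  unfold D3
  split_ifs with h1 h2 h3
  · refine (diagNorm_mul_rearrMax_le_integral_iSup (one_le_conjExponent hq)
      (conjExponent_le_two hq h1.2) (transpose_tensor hA) hg.swap).trans_eq ?_
    congr 2
    ext ω
    exact (Equiv.prodComm (Fin n) (Fin m)).iSup_comp
      (g := fun ij : Fin m × Fin n => |A ij.1 ij.2 * g ij.1 ij.2 ω|)
  · change _ ≤ 19 * rearrMax (colNorm q A)
    rw [rearrMax_colNorm hq h2.2 hA]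
    have := mul_nonneg (diagNorm_nonneg q.conjExponent a) (rearrMax_nonneg b)
    linarith
  · exact absurd h3.1 (by norm_num)
  · rcases le_total q 2 with h | h
    · exact absurd ⟨hq, h⟩ h2
    · exact absurd ⟨one_le_two, h⟩ h1

variable (a b) in
/-- Chevet's inequality with the conjugate exponents of the statement. -/
lemma integral_ellOpNorm_le_of_moments (hp : 1 ≤ p) (hq : 1 ≤ q)
    (hA : ∀ i j, A i j = a i * b j) (hg : IsIIDStdGaussian g μ) {S T : ℝ}
    (hS : ∀ h : Fin m → (ChevetIndex m n → ℝ) → ℝ,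
      (∀ i, HasLaw (h i) (gaussianReal 0 1) (gaussPi (ChevetIndex m n))) →
      diagNorm p b * ∫ x, ellNorm q (fun i => a i * h i x) ∂(gaussPi (ChevetIndex m n)) ≤ S)
    (hT : ∀ h : Fin n → (ChevetIndex m n → ℝ) → ℝ,
      (∀ j, HasLaw (h j) (gaussianReal 0 1) (gaussPi (ChevetIndex m n))) →
      diagNorm q.conjExponent a
        * ∫ x, ellNorm p.conjExponent (fun j => b j * h j x) ∂(gaussPi (ChevetIndex m n)) ≤ T) :
    ∫ ω, ellOpNorm p q (structuredMatrix A g ω) ∂μ ≤ √2 * (S + T) := by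
  have := ENNReal.HolderConjugate.conjExponent hp
  have := ENNReal.HolderConjugate.conjExponent hq
  refine (chevet (p' := p.conjExponent) (q' := q.conjExponent) hA hg).trans ?_
  gcongr
  · exact hS (fun i x => x (.inr (.inl i))) fun i => hasLaw_eval_gaussPi _
  · exact hT (fun j x => x (.inr (.inr j))) fun j => hasLaw_eval_gaussPi _

lemma diagNorm_mul_integral_ellNorm_le {k l : ℕ} {Ω' : Type*} [MeasurableSpace Ω']
    {ν : Measure Ω'} [IsProbabilityMeasure ν] {r s : ℝ≥0∞} (hr : 1 ≤ r) (hr' : r ≠ ∞)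
    (c : Fin k → ℝ) (d : Fin l → ℝ) {h : Fin k → Ω' → ℝ}
    (hh : ∀ i, HasLaw (h i) (gaussianReal 0 1) ν) :
    diagNorm s d * ∫ x, ellNorm r (fun i => c i * h i x) ∂ν
      ≤ 2 * √r.toReal * (ellNorm r c * diagNorm s d) := by
  refine (mul_le_mul_of_nonneg_left (integral_ellNorm_gaussian_le hr hr' hh)
    (diagNorm_nonneg s d)).trans_eq (by ring)

lemma diagNorm_mul_integral_ellNorm_top_le {k l : ℕ} {Ω' : Type*} [MeasurableSpace Ω']
    {ν : Measure Ω'} [IsProbabilityMeasure ν] {s : ℝ≥0∞}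
    (c : Fin k → ℝ) (d : Fin l → ℝ) {h : Fin k → Ω' → ℝ}
    (hh : ∀ i, HasLaw (h i) (gaussianReal 0 1) ν) :
    diagNorm s d * ∫ x, ellNorm ∞ (fun i => c i * h i x) ∂ν
      ≤ 25 * (diagNorm s d * rearrMax c) :=
  (mul_le_mul_of_nonneg_left (integral_ellNorm_top_gaussian_le c hh)
    (diagNorm_nonneg s d)).trans_eq (by ring)

lemma D1_nonneg (p q : ℝ≥0∞) (A : Matrix (Fin m) (Fin n) ℝ) : 0 ≤ D1 p q A := Real.sqrt_nonneg _

lemma D2_nonneg (p q : ℝ≥0∞) (A : Matrix (Fin m) (Fin n) ℝ) : 0 ≤ D2 p q A := Real.sqrt_nonneg _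

/-- Here 475 = 25 · 19, from the upper bound for the maximum and its control by D₃. It takes over
when q = ∞ or p* = ∞, where `toReal` is 0; at finite exponents D₁ and D₂ suffice. -/
lemma integral_ellOpNorm_le (hp : 1 ≤ p) (hq : 1 ≤ q)
    (hA : ∀ i j, A i j = a i * b j) (hg : IsIIDStdGaussian g μ) :
    ∫ ω, ellOpNorm p q (structuredMatrix A g ω) ∂μ
      ≤ √2 * ((2 * √q.toReal + 475) + (2 * √p.conjExponent.toReal + 475))
        * (D1 p q A + D2 p q A + D3 p q A g μ) := by
  have hp0 : 0 < p := zero_lt_one.trans_le hp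
  have hq0 : 0 < q := zero_lt_one.trans_le hq
  have h1 := D1_nonneg p q A
  have h2 := D2_nonneg p q A
  have h3 : 0 ≤ D3 p q A g μ := D3_nonneg A g
  rw [mul_assoc, add_mul (2 * √q.toReal + 475)]
  refine integral_ellOpNorm_le_of_moments a b hp hq hA hg (fun h hh => ?_) fun h hh => ?_
  · have hs := Real.sqrt_nonneg q.toReal
    by_cases hq' : q = ∞
    · subst hq'
      have e1 := diagNorm_mul_integral_ellNorm_top_le (s := p) a b hh
      have e2 := diagNorm_mul_rearrMax_le_D3_top hp hA hg
      nlinarith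
    · have e1 := diagNorm_mul_integral_ellNorm_le (s := p) hq hq' a b hh
      rw [← D1_eq_of_tensor hp0 hq0 hA] at e1
      refine e1.trans ?_
      gcongr <;> linarith
  · have hs := Real.sqrt_nonneg p.conjExponent.toReal
    by_cases hp' : p.conjExponent = ∞
    · have hp1 : p = 1 := by
        have := (ENNReal.HolderConjugate.conjExponent hp).symm
        rw [hp'] at this
        exact ENNReal.HolderConjugate.unique ∞ p 1
      subst hp1
      rw [hp'] at hs ⊢
      have e1 := diagNorm_mul_integral_ellNorm_top_le (s := q.conjExponent) b a hh
      have e2 := diagNorm_mul_rearrMax_le_D3_one hq hA hg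
      nlinarith
    · have e1 := diagNorm_mul_integral_ellNorm_le (s := q.conjExponent)
        (one_le_conjExponent hp) hp' b a hh
      rw [← D2_eq_of_tensor hp hq hA] at e1
      refine e1.trans ?_
      gcongr <;> linarith

lemma integral_ellOpNorm_le_of_ne_top (hp : 1 ≤ p) (hq : 1 ≤ q) (hp' : p.conjExponent ≠ ∞)
    (hq' : q ≠ ∞) (hA : ∀ i j, A i j = a i * b j) (hg : IsIIDStdGaussian g μ) :
    ∫ ω, ellOpNorm p q (structuredMatrix A g ω) ∂μ
      ≤ √2 * 2 * (√q.toReal * D1 p q A + √p.conjExponent.toReal * D2 p q A) := by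
  rw [mul_assoc, mul_add, ← mul_assoc, ← mul_assoc 2]
  refine integral_ellOpNorm_le_of_moments a b hp hq hA hg (fun h hh => ?_) fun h hh => ?_
  · rw [D1_eq_of_tensor (zero_lt_one.trans_le hp) (zero_lt_one.trans_le hq) hA]
    exact diagNorm_mul_integral_ellNorm_le hq hq' a b hh
  · rw [D2_eq_of_tensor hp hq hA]
    exact diagNorm_mul_integral_ellNorm_le (one_le_conjExponent hp) hp' b a hh

end Assembly

theorem corollary3p2 :
    -- the conjectured two-sided bound, with constants depending only on `p`, `q`
    (∀ p q : ℝ≥0∞, 1 ≤ p → 1 ≤ q → ∃ c C : ℝ, 0 < c ∧ 0 < C ∧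
      ∀ (m n : ℕ) (A : Matrix (Fin m) (Fin n) ℝ),
        (∃ (a : Fin m → ℝ) (b : Fin n → ℝ), ∀ i j, A i j = a i * b j) →
      ∀ (Ω : Type*) [MeasurableSpace Ω] (μ : Measure Ω) [IsProbabilityMeasure μ]
        (g : Fin m → Fin n → Ω → ℝ), IsIIDStdGaussian g μ →
        Integrable (fun ω => ellOpNorm p q (structuredMatrix A g ω)) μ ∧
        c * (D1 p q A + D2 p q A + D3 p q A g μ)
          ≤ ∫ ω, ellOpNorm p q (structuredMatrix A g ω) ∂μ ∧
        ∫ ω, ellOpNorm p q (structuredMatrix A g ω) ∂μ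
          ≤ C * (D1 p q A + D2 p q A + D3 p q A g μ)) ∧
    -- the sharper bound for `p*, q < ∞`, with universal constants
    (∃ c C : ℝ, 0 < c ∧ 0 < C ∧
      ∀ p q : ℝ≥0∞, 1 ≤ p → 1 ≤ q → p.conjExponent < ∞ → q < ∞ →
      ∀ (m n : ℕ) (A : Matrix (Fin m) (Fin n) ℝ),
        (∃ (a : Fin m → ℝ) (b : Fin n → ℝ), ∀ i j, A i j = a i * b j) →
      ∀ (Ω : Type*) [MeasurableSpace Ω] (μ : Measure Ω) [IsProbabilityMeasure μ]
        (g : Fin m → Fin n → Ω → ℝ), IsIIDStdGaussian g μ →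
        c * (D1 p q A + D2 p q A)
          ≤ ∫ ω, ellOpNorm p q (structuredMatrix A g ω) ∂μ ∧
        ∫ ω, ellOpNorm p q (structuredMatrix A g ω) ∂μ
          ≤ C * (√(q.toReal) * D1 p q A + √(p.conjExponent.toReal) * D2 p q A)) := by

  -- Lower bounds 1/27, 1/27 and 1/19 for the three terms add up to 73 = 27 + 27 + 19; without D₃
  -- the sum is 54.
  refine ⟨fun p q hp hq => ⟨1 / 73,
    √2 * ((2 * √q.toReal + 475) + (2 * √p.conjExponent.toReal + 475)), by norm_num, by positivity,
    ?_⟩, 1 / 54, √2 * 2, by norm_num, by positivity, ?_⟩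
  · rintro m n A ⟨a, b, hA⟩ Ω _ μ _ g hg
    refine ⟨hg.integrable_ellOpNorm (zero_lt_one.trans_le hp) hq A, ?_,
      integral_ellOpNorm_le hp hq hA hg⟩
    have h1 := D1_le_integral_ellOpNorm hp hq hA hg
    have h2 := D2_le_integral_ellOpNorm hp hq hA hg
    have h3 := D3_le_integral_ellOpNorm hp hq hA hg
    linarith
  · rintro p q hp hq hp' hq' m n A ⟨a, b, hA⟩ Ω _ μ _ g hg
    refine ⟨?_, integral_ellOpNorm_le_of_ne_top hp hq hp'.ne hq'.ne hA hg⟩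
    have h1 := D1_le_integral_ellOpNorm hp hq hA hg
    have h2 := D2_le_integral_ellOpNorm hp hq hA hg
    linarith
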